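/- Let $G_0=(V_1\cup V_2,E)$ be a finite bipartite graph with parts $V_1,V_2$. Let $G$ be $G_0$ together with two new isolated vertices, and number the vertices of $G$ as $v_1,\dots,v_n$ so that first come the vertices of $V_1$, then the two new vertices, then the vertices of $V_2$ (hence $j\ge i+3$ for every edge $v_iv_j$ with $i<j$). Put $y=10n^2$; "joining $a$ and $b$ by a path of length $m$" means adding $m-1$ new inner vertices. The graph $G'$ is built as follows. * For $c\in\{t,b\}$ take vertices $u^c_1,\dots,u^c_n$ and join $u^c_i$ to $u^c_{i+1}$ by a path of length $y$ (the top line for $c=t$, the bottom line for $c=b$). To each of $u^t_1,u^t_n,u^b_1,u^b_n$ attach a path on three new vertices by an edge to its middle vertex; let $u^t_\ell,u^t_r,u^b_\ell,u^b_r$, respectively, be an arbitrarily chosen end vertex of that three-vertex path. * For each $i$ take a cycle of length $2n+2$ formed by the two paths $a^t_i,l^i_1,\dots,l^i_n,a^b_i$ and $a^t_i,r^i_1,\dots,r^i_n,a^b_i$, and join $a^t_i$ to $u^t_i$ and $a^b_i$ to $u^b_i$ by paths of length $y$. * For each edge $v_iv_j$ of $G$ with $i<j$ join $r^i_j$ and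 $r^j_i$ by a path $R_{ij}=R_{ji}$ of length $(j-i+\tfrac32)y$; join the vertex of $R_{ij}$ at distance $y$ along $R_{ij}$ from $r^i_j$ by a path of length $y$ to the vertex of the top line between $u^t_i$ and $u^t_j$ at distance $j$ along the line from $u^t_i$, and join the vertex of $R_{ij}$ at distance $y$ along $R_{ij}$ from $r^j_i$ by a path of length $y$ to the vertex of the top line between $u^t_i$ and $u^t_j$ at distance $i$ along the line from $u^t_j$. A metric basis of a graph is a set $L$ of vertices such that for any two distinct vertices $a,b$ some $x\in L$ has $\operatorname{dist}(x,a)\ne\operatorname{dist}(x,b)$. Let $h\ge 0$ be an integer. Then: 1. If $G$ has a dominating set of size at most $h$, then $G'$ has a metric basis of size at most $h+4$. Consequently, if $G_0$ has a dominating set of size at most $h$, then $G'$ has a metric basis of size at most $(h+2)+4$. 2. More precisely, if $K$ is a dominating set of $G$ of size at most $h$, then $\{u^t_\ell,u^t_r,u^b_\ell,u^b_r\}\cup\{r^i_1: v_i\in K\}$ is a metric basis of $G'$, of size at most $h+4$. 3. For every edge $v_\alpha v_i$ of $G$ and every $1\le j\le n$, the path from $r^\alpha_1$ to $r^i_j$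 that runs along the right-vertices $r^\alpha_1,\dots,r^\alpha_i$, then along $R_{\alpha i}$ to $r^i_\alpha$, then along the right-vertices between $r^i_\alpha$ and $r^i_j$ is the unique shortest path in $G'$ from $r^\alpha_1$ to $r^i_j$. -/

import Mathlib

namespace MetricDim

/-- `K` is a dominating set of `G`: the closed neighbourhood of every vertex meets `K`. -/
def IsDominatingSet {V : Type*} (G : SimpleGraph V) (K : Set V) : Prop :=
  ∀ x, ∃ d ∈ K, d = x ∨ G.Adj x d

/-- `L` is a metric basis (resolving set) of `G`: any two distinct vertices have different distances
to some member of `L`. (Distances are extended, so the notion is also right for disconnected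
graphs.) -/
def IsMetricBasis {W : Type*} (G : SimpleGraph W) (L : Set W) : Prop :=
  ∀ a b, a ≠ b → ∃ x ∈ L, G.edist x a ≠ G.edist x b

/-- `(G, h)` is a yes-instance of the dominating set problem. -/
def HasDominatingSet {V : Type*} (G : SimpleGraph V) (h : ℕ) : Prop :=
  ∃ K : Set V, IsDominatingSet G K ∧ K.encard ≤ h

/-- `(G, k)` is a yes-instance of the metric dimension problem. -/
def HasMetricBasis {W : Type*} (G : SimpleGraph W) (k : ℕ) : Prop :=
  ∃ L : Set W, IsMetricBasis G L ∧ L.encard ≤ k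

/-- The disjoint union of `G` with two isolated vertices. -/
def addTwoIsolated {V : Type*} (G : SimpleGraph V) : SimpleGraph (V ⊕ Fin 2) :=
  SimpleGraph.sum G ⊥

/-- The graph on `{0, …, n - 1}` obtained from `G` by a numbering of its vertices. -/
def numbered {V : Type*} {n : ℕ} (G : SimpleGraph V) (num : V ≃ Fin n) :
    SimpleGraph (Fin n) :=
  G.comap num.symm

/-- The graph `G` that consists of `G₀` and two isolated vertices, on the set `{0, …, n - 1}` of
indices. -/
abbrev padded {V : Type*} {n : ℕ} (G₀ : SimpleGraph V) (num : V ⊕ Fin 2 ≃ Fin n) :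
    SimpleGraph (Fin n) :=
  numbered (addTwoIsolated G₀) num

/-- Top line or bottom line. -/
inductive Row
  | top
  | bottom

inductive Side
  | left
  | right

/-- The length `y = 10 n ^ 2` of a `y`-path. -/
def y (n : ℕ) : ℕ := 10 * n ^ 2

/-- The length `(j - i + 3/2) y` of the path joining `r^i_j` and `r^j_i` (`y` is even). -/
def edgeLen {n : ℕ} (i j : Fin n) : ℕ := (j.val - i.val) * y n + 3 * (y n / 2)

/-- The vertices of the graph `G'` constructed from a graph `H` on the vertices `v_1, …, v_n`.
The index `i : Fin n` stands for `v_{i+1}`.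
* `line c p`: the vertex at position `p` of the top or bottom line; `u^c_{i+1}` has position `i y`.
* `pendMid c s`, `pendLeaf c s b`: the middle vertex and the two degree-one vertices of the `P_3`
  attached to the left or right endpoint of the line `c`.
* `anchor c i`: the anchors of the `i`-th vertex gadget.
* `arm left i j` and `arm right i j`: the vertices `l^{i+1}_{j+1}` and `r^{i+1}_{j+1}`.
* `spoke c i k`: the inner vertex at distance `k` from the anchor on the `y`-path from that anchor
  to the line `c`.
* `edgePath i j k`: the inner vertex at distance `k` from `r^{i+1}_{j+1}` on the path from
  `r^{i+1}_{j+1}` to `r^{j+1}_{i+1}`, for an edge with `i < j`.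
* `branch left i j k`, `branch right i j k`: the inner vertex at distance `k` from `w_1`, resp.
  `w_2`, on the `y`-path from there to the top line. -/
inductive Vertex {n : ℕ} (H : SimpleGraph (Fin n)) : Type
  | line (c : Row) (p : ℕ) (hp : p ≤ (n - 1) * y n)
  | pendMid (c : Row) (s : Side)
  | pendLeaf (c : Row) (s : Side) (b : Bool)
  | anchor (c : Row) (i : Fin n)
  | arm (s : Side) (i j : Fin n)
  | spoke (c : Row) (i : Fin n) (k : ℕ) (hk : 0 < k ∧ k < y n)
  | edgePath (i j : Fin n) (hij : i < j) (e : H.Adj i j) (k : ℕ) (hk : 0 < k ∧ k < edgeLen i j)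
  | branch (s : Side) (i j : Fin n) (hij : i < j) (e : H.Adj i j) (k : ℕ) (hk : 0 < k ∧ k < y n)

open Vertex in
/-- The edges of `G'`, each listed in one direction. -/
inductive Step {n : ℕ} (H : SimpleGraph (Fin n)) : Vertex H → Vertex H → Prop
  /- the two lines -/
  | line_line (c p hp hp') : Step H (line c p hp) (line c (p + 1) hp')
  /- the four pending `P_3`'s -/
  | leaf_mid (c s b) : Step H (pendLeaf c s b) (pendMid c s)
  | mid_left (c hp) : Step H (pendMid c .left) (line c 0 hp)
  | mid_right (c hp) : Step H (pendMid c .right) (line c ((n - 1) * y n) hp)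
  /- the cycle of a vertex gadget -/
  | top_arm (s i j) : j.val = 0 → Step H (anchor .top i) (arm s i j)
  | arm_arm (s i j j') : j'.val = j.val + 1 → Step H (arm s i j) (arm s i j')
  | arm_bottom (s i j) : j.val + 1 = n → Step H (arm s i j) (anchor .bottom i)
  /- the `y`-paths from the anchors to the lines -/
  | anchor_spoke (c i hk) : Step H (anchor c i) (spoke c i 1 hk)
  | spoke_spoke (c i k hk hk') : Step H (spoke c i k hk) (spoke c i (k + 1) hk')
  | spoke_line (c i k hk p hp) : k + 1 = y n → p = i.val * y n →
      Step H (spoke c i k hk) (line c p hp)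
  /- the path from `r^i_j` to `r^j_i` of an edge gadget -/
  | arm_edge (i j hij e hk) : Step H (arm .right i j) (edgePath i j hij e 1 hk)
  | edge_edge (i j hij e k hk hk') :
      Step H (edgePath i j hij e k hk) (edgePath i j hij e (k + 1) hk')
  | edge_arm (i j hij e k hk) : k + 1 = edgeLen i j →
      Step H (edgePath i j hij e k hk) (arm .right j i)
  /- the `y`-path from `w_1` to the vertex of the top line at distance `j` to the right of `u^t_i` -/
  | edge_branch_left (i j hij e k hk hk') : k = y n →
      Step H (edgePath i j hij e k hk) (branch .left i j hij e 1 hk')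
  | branch_left_line (i j hij e k hk p hp) : k + 1 = y n → p = i.val * y n + (j.val + 1) →
      Step H (branch .left i j hij e k hk) (line .top p hp)
  /- the `y`-path from `w_2` to the vertex of the top line at distance `i` to the left of `u^t_j` -/
  | edge_branch_right (i j hij e k hk hk') : k + y n = edgeLen i j →
      Step H (edgePath i j hij e k hk) (branch .right i j hij e 1 hk')
  | branch_right_line (i j hij e k hk p hp) : k + 1 = y n → p + (i.val + 1) = j.val * y n →
      Step H (branch .right i j hij e k hk) (line .top p hp)
  | branch_branch (s i j hij e k hk hk') :
      Step H (branch s i j hij e k hk) (branch s i j hij e (k + 1) hk')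

/-- The graph `G'`. -/
def reduction {n : ℕ} (H : SimpleGraph (Fin n)) : SimpleGraph (Vertex H) :=
  SimpleGraph.fromRel (Step H)

/-- The vertex `r^i_j`. -/
abbrev rVertex {n : ℕ} (H : SimpleGraph (Fin n)) (i j : Fin n) : Vertex H := .arm .right i j

/-- The vertex `r^i_1`. -/
abbrev rFirst {n : ℕ} (H : SimpleGraph (Fin n)) (i : Fin n) : Vertex H :=
  rVertex H i ⟨0, i.pos⟩

/-- The set of the four corners `u^t_ℓ, u^t_r, u^b_ℓ, u^b_r` and the vertices `r^i_1` with `i ∈ K`.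
The function `b` says which of the two degree-one vertices of each `P_3` is the corner. -/
def basisOf {n : ℕ} (H : SimpleGraph (Fin n)) (b : Row → Side → Bool) (K : Set (Fin n)) :
    Set (Vertex H) :=
  {x | ∃ c s, x = .pendLeaf c s (b c s)} ∪ rFirst H '' K

/-- The vertices of the path `r^α_1, …, r^α_i`, then through the edge gadget of `v_α v_i` to
`r^i_α`, then along the right-vertices to `r^i_j`. -/
def gadgetRoute {n : ℕ} (H : SimpleGraph (Fin n)) (α i j : Fin n) : Set (Vertex H) :=
  {x | (∃ t, t ≤ i ∧ x = rVertex H α t) ∨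
    (∃ (a b : Fin n) (hab : a < b) (e : H.Adj a b) (k : ℕ) (hk : 0 < k ∧ k < edgeLen a b),
      s(a, b) = s(α, i) ∧ x = .edgePath a b hab e k hk) ∨
    (∃ t ∈ Set.uIcc α j, x = rVertex H i t)}

end MetricDim

/-!
The distances from the leaf `u^c_s` are given by an explicit 1-Lipschitz potential that decreases
along some edge at every other vertex: enter each gadget through the cheapest of its attachments.
Since all connecting paths have length of order `n²`, against `n` for the cycles, the four numbers
obtained this way determine a vertex except in two situations: `l^i_j` and `r^i_j` are twins, and a
vertex of a path `R_{ij}` may be confused with one on a branch hanging from it.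

Twins are separated by a dominating vertex `v_α` of `v_i`: from `r^α_1` the way to `r^i_j` through
`R_{αi}` is shorter than any way to `l^i_j`, as a potential centred at `l^i_j` shows. A potential
centred at `r^i_j` shows that this way is the unique shortest path. The remaining pairs are
separated by `r^m_1`, where `v_m` is an isolated vertex numbered between the two parts; it belongs
to every dominating set, and no gadget of an edge helps to leave its cycle.
-/

namespace MetricDim

section Potentials

variable {W : Type*} {G : SimpleGraph W} {f : W → ℕ}

theorem le_add_length_of_lipschitz (hf : ∀ u v, G.Adj u v → f u ≤ f v + 1) {u v : W}
    (p : G.Walk u v) : f u ≤ f v + p.length := by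
  induction p with
  | nil => simp
  | cons h p ih =>
    have := hf _ _ h
    rw [SimpleGraph.Walk.length_cons]
    omega

theorem le_edist_of_lipschitz (hf : ∀ u v, G.Adj u v → f u ≤ f v + 1) {r : W} (hr : f r = 0)
    (v : W) : (f v : ℕ∞) ≤ G.edist r v := by
  by_cases h : G.edist v r = ⊤
  · simp [G.edist_comm (u := r), h]
  · obtain ⟨p, hp⟩ := SimpleGraph.exists_walk_of_edist_ne_top h
    have := le_add_length_of_lipschitz hf p
    rw [SimpleGraph.edist_comm, ← hp]
    exact_mod_cast (by omega : f v ≤ p.length)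

theorem edist_le_of_descent {r : W} {S : Set W}
    (hS : ∀ v ∈ S, v = r ∨ ∃ u ∈ S, G.Adj u v ∧ f u < f v) {v : W} (hv : v ∈ S) :
    G.edist r v ≤ f v := by
  induction h : f v using Nat.strong_induction_on generalizing v with
  | _ m ih =>
    rcases hS v hv with rfl | ⟨u, hu, hadj, hlt⟩
    · simp
    · have hru := ih (f u) (h ▸ hlt) hu rfl
      calc G.edist r v ≤ G.edist r u + G.edist u v := G.edist_triangle
        _ ≤ f u + 1 := by
          gcongr
          exact (SimpleGraph.edist_eq_one_iff_adj.2 hadj).le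
        _ ≤ m := by
          rw [← h]
          exact_mod_cast hlt

theorem edist_eq_of_lipschitz_of_descent (hf : ∀ u v, G.Adj u v → f u ≤ f v + 1) {r : W}
    (hr : f r = 0) (hdesc : ∀ v, v = r ∨ ∃ u, G.Adj u v ∧ f u < f v) (v : W) :
    G.edist r v = f v :=
  (edist_le_of_descent (S := Set.univ) (by simpa using hdesc) trivial).antisymm
    (le_edist_of_lipschitz hf hr v)

theorem length_cons_lt_of_forall_descent_eq (hf : ∀ u v, G.Adj u v → f u ≤ f v + 1) {u v T : W}
    (hT : f T = 0) (huT : u ≠ T) (hadj : G.Adj u v) (hv : ∀ w, G.Adj u w → f w < f u → w = v)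
    {P : G.Walk v T} (hP : P.length < f u) (hmin : ∀ Q, Q ≠ P → P.length < Q.length)
    {Q : G.Walk u T} (hQ : Q ≠ .cons hadj P) : (P.cons hadj).length < Q.length := by
  cases Q with
  | nil => exact absurd rfl huT
  | @cons _ w _ hw Q' =>
    simp only [SimpleGraph.Walk.length_cons, Nat.add_lt_add_iff_right]
    by_cases hlt : f w < f u
    · obtain rfl := hv w hw hlt
      exact hmin Q' fun h => hQ (h ▸ rfl)
    · have := le_add_length_of_lipschitz hf Q'
      omega

/-- The potential `f` measures the remaining length along the route `S`. -/
theorem exists_unique_shortest_walk {S : Set W} {T : W} (hT : T ∈ S) (hinj : Set.InjOn f S)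
    (hT0 : f T = 0) (hf : ∀ u v, G.Adj u v → f u ≤ f v + 1)
    (hclosed : ∀ u ∈ S, ∀ v, G.Adj u v → f v < f u → v ∈ S)
    (hdesc : ∀ u ∈ S, u ≠ T → ∃ v ∈ S, G.Adj u v ∧ f v < f u) {u : W} (hu : u ∈ S) :
    ∃ P : G.Walk u T, P.length = f u ∧ (∀ x, x ∈ P.support ↔ x ∈ S ∧ f x ≤ f u) ∧
      ∀ Q : G.Walk u T, Q ≠ P → P.length < Q.length := by
  induction h : f u using Nat.strong_induction_on generalizing u with
  | _ m ih =>
    by_cases huT : u = T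
    · subst huT
      refine ⟨.nil, by simp [← h, hT0], fun x => ?_, fun Q hQ => ?_⟩
      · rw [SimpleGraph.Walk.support_nil, List.mem_singleton]
        exact ⟨fun hx => hx ▸ ⟨hu, h.le⟩, fun ⟨hx, _⟩ => hinj hx hu (by omega)⟩
      · cases Q with
        | nil => exact absurd rfl hQ
        | cons _ _ => simp
    · obtain ⟨v, hv, hadj, hlt⟩ := hdesc u hu huT
      have huv := hf _ _ hadj
      obtain ⟨P, hP, hsupp, hmin⟩ := ih (f v) (by omega) hv rfl
      refine ⟨P.cons hadj, by rw [SimpleGraph.Walk.length_cons]; omega, fun x => ?_, fun Q hQ =>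
        length_cons_lt_of_forall_descent_eq hf hT0 huT hadj (fun w hw hwu => ?_) (by omega) hmin hQ⟩
      · simp only [SimpleGraph.Walk.support_cons, List.mem_cons, hsupp]
        constructor
        · rintro (rfl | ⟨hx, hxv⟩)
          · exact ⟨hu, h.le⟩
          · exact ⟨hx, by omega⟩
        · rintro ⟨hx, hxm⟩
          by_cases hxu : f x = f u
          · exact Or.inl (hinj hx hu hxu)
          · exact Or.inr ⟨hx, by omega⟩
      · have := hf _ _ hw
        exact hinj (hclosed u hu w hw hwu) hv (by omega)

end Potentials

section LowerEnvelope

/-- The largest `1`-Lipschitz function on `ℕ` that is at most `v` at `p` for every pair `(p, v)` of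
`S`. It is used as the distance from a vertex to the points of a path whose other vertices have
degree two, the pairs in `S` being the places where that path can be entered. -/
noncomputable def lowerEnvelope (S : Set (ℕ × ℕ)) (k : ℕ) : ℕ :=
  sInf ((fun x => x.2 + Nat.dist x.1 k) '' S)

variable {S : Set (ℕ × ℕ)} {p v k m : ℕ}

theorem lowerEnvelope_le (hx : (p, v) ∈ S) : lowerEnvelope S k ≤ v + Nat.dist p k :=
  Nat.sInf_le ⟨_, hx, rfl⟩

theorem exists_lowerEnvelope_eq (hS : S.Nonempty) (k : ℕ) :
    ∃ p v, (p, v) ∈ S ∧ lowerEnvelope S k = v + Nat.dist p k := by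
  obtain ⟨⟨p, v⟩, hx, h⟩ := Nat.sInf_mem (hS.image fun x : ℕ × ℕ => x.2 + Nat.dist x.1 k)
  exact ⟨p, v, hx, h.symm⟩

theorem le_lowerEnvelope (hS : S.Nonempty) (h : ∀ p v, (p, v) ∈ S → m ≤ v + Nat.dist p k) :
    m ≤ lowerEnvelope S k := by
  obtain ⟨p, v, hx, heq⟩ := exists_lowerEnvelope_eq hS k
  exact heq ▸ h p v hx

theorem dist_lowerEnvelope_succ (hS : S.Nonempty) (k : ℕ) :
    Nat.dist (lowerEnvelope S k) (lowerEnvelope S (k + 1)) ≤ 1 := by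
  obtain ⟨p, v, hx, h⟩ := exists_lowerEnvelope_eq hS k
  obtain ⟨p', v', hx', h'⟩ := exists_lowerEnvelope_eq hS (k + 1)
  have hle := lowerEnvelope_le (k := k + 1) hx
  have hle' := lowerEnvelope_le (k := k) hx'
  simp only [Nat.dist] at *
  omega

theorem exists_mem_lowerEnvelope_descent (hS : S.Nonempty) (k : ℕ) :
    ∃ p v, (p, v) ∈ S ∧ (p < k ∧ lowerEnvelope S (k - 1) < lowerEnvelope S k ∨
      k < p ∧ lowerEnvelope S (k + 1) < lowerEnvelope S k ∨ p = k ∧ lowerEnvelope S k = v) := by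
  obtain ⟨p, v, hx, h⟩ := exists_lowerEnvelope_eq hS k
  have hpred := lowerEnvelope_le (k := k - 1) hx
  have hsucc := lowerEnvelope_le (k := k + 1) hx
  refine ⟨p, v, hx, ?_⟩
  simp only [Nat.dist] at *
  omega

end LowerEnvelope

section PathValue

/-- The values along a path of length `L` whose ends have the values `A` and `B`. -/
noncomputable def pathValue (L A B : ℕ) : ℕ → ℕ :=
  lowerEnvelope {(0, A), (L, B)}

variable {L A B k m : ℕ}

theorem dist_pathValue_succ : Nat.dist (pathValue L A B k) (pathValue L A B (k + 1)) ≤ 1 :=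
  dist_lowerEnvelope_succ (by simp) k

theorem pathValue_eq (hk : k ≤ L) (h₁ : m ≤ A + k) (h₂ : m ≤ B + (L - k))
    (h : m = A + k ∨ m = B + (L - k)) : pathValue L A B k = m := by
  have hA : pathValue L A B k ≤ _ := lowerEnvelope_le (show (0, A) ∈ _ by simp)
  have hB : pathValue L A B k ≤ _ := lowerEnvelope_le (show (L, B) ∈ _ by simp)
  have hm : m ≤ pathValue L A B k := by
    refine le_lowerEnvelope (by simp) fun p v hx => ?_
    rcases hx with ⟨rfl, rfl⟩ | ⟨rfl, rfl⟩ <;> simp only [Nat.dist] <;> omega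
  simp only [Nat.dist] at hA hB
  omega

theorem pathValue_eq_min (hk : k ≤ L) : pathValue L A B k = min (A + k) (B + (L - k)) :=
  pathValue_eq hk (min_le_left _ _) (min_le_right _ _) (min_choice _ _)

theorem pathValue_zero (h : Nat.dist A B ≤ L) : pathValue L A B 0 = A := by
  rw [pathValue_eq_min (Nat.zero_le L)]
  simp only [Nat.dist] at h
  omega

theorem pathValue_length (h : Nat.dist A B ≤ L) : pathValue L A B L = B := by
  rw [pathValue_eq_min le_rfl]
  simp only [Nat.dist] at h
  omega

theorem pathValue_descent (hk : 0 < k ∧ k < L) :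
    pathValue L A B (k - 1) < pathValue L A B k ∨ pathValue L A B (k + 1) < pathValue L A B k := by
  rw [pathValue_eq_min (by omega), pathValue_eq_min hk.2.le, pathValue_eq_min (by omega)]
  omega

end PathValue

section EdgeValue

/-- The values along a path of length `L` whose ends have the values `A` and `B`; at distance `Y`
from the first and the second end, paths of length `Y` branch off that lead to vertices of values
`C` and `D`. -/
noncomputable def edgeValue (Y L A B C D : ℕ) : ℕ → ℕ :=
  lowerEnvelope {(0, A), (L, B), (Y, C + Y), (L - Y, D + Y)}

/-- The differences of the values `A`, `B`, `C`, `D` in `edgeValue` are bounded by the distances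
within the edge path and its two branches. -/
structure EdgeCompatible (Y L A B C D : ℕ) : Prop where
  ends : Nat.dist A B ≤ L
  near_left : Nat.dist A C ≤ 2 * Y
  far_left : Nat.dist A D ≤ L
  far_right : Nat.dist B C ≤ L
  near_right : Nat.dist B D ≤ 2 * Y
  feet : Nat.dist C D ≤ L

variable {Y L A B C D k m : ℕ}

theorem dist_edgeValue_succ :
    Nat.dist (edgeValue Y L A B C D k) (edgeValue Y L A B C D (k + 1)) ≤ 1 :=
  dist_lowerEnvelope_succ (by simp) k

theorem le_edgeValue (h₁ : m ≤ A + Nat.dist 0 k) (h₂ : m ≤ B + Nat.dist L k)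
    (h₃ : m ≤ C + Y + Nat.dist Y k) (h₄ : m ≤ D + Y + Nat.dist (L - Y) k) :
    m ≤ edgeValue Y L A B C D k := by
  refine le_lowerEnvelope (by simp) fun p v hx => ?_
  rcases hx with ⟨rfl, rfl⟩ | ⟨rfl, rfl⟩ | ⟨rfl, rfl⟩ | ⟨rfl, rfl⟩ <;> assumption

theorem edgeValue_le : edgeValue Y L A B C D k ≤ A + Nat.dist 0 k ∧
    edgeValue Y L A B C D k ≤ B + Nat.dist L k ∧
    edgeValue Y L A B C D k ≤ C + Y + Nat.dist Y k ∧
    edgeValue Y L A B C D k ≤ D + Y + Nat.dist (L - Y) k :=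
  ⟨lowerEnvelope_le (by simp), lowerEnvelope_le (by simp), lowerEnvelope_le (by simp),
    lowerEnvelope_le (by simp)⟩

theorem cast_edgeValue_eq {m : ℤ} (hk : k + Y ≤ L) (h₁ : m ≤ A + k) (h₂ : m ≤ B + L - k)
    (h₃ : m ≤ C + max (2 * Y - k : ℤ) k) (h₄ : m ≤ D + L - k)
    (h : m = A + k ∨ m = B + L - k ∨ m = C + max (2 * Y - k : ℤ) k ∨ m = D + L - k) :
    (edgeValue Y L A B C D k : ℤ) = m := by
  have hC : C + Y + Nat.dist Y k = C + max (2 * Y - k : ℤ) k := by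
    simp only [Nat.dist]
    omega
  have hB : Nat.dist L k = L - k := Nat.dist_eq_sub_of_le_right (by omega)
  have hD : Nat.dist (L - Y) k = L - Y - k := Nat.dist_eq_sub_of_le_right (by omega)
  have hm : m.toNat ≤ edgeValue Y L A B C D k := by
    rw [← hC] at h₃
    refine le_edgeValue ?_ ?_ (by omega) ?_ <;>
      simp only [Nat.dist_zero_left, hB, hD] <;> omega
  have hle := edgeValue_le (Y := Y) (L := L) (A := A) (B := B) (C := C) (D := D) (k := k)
  rw [Nat.dist_zero_left, hB, hD] at hle
  omega

theorem edgeValue_sub_le (hL : Y ≤ L) (hk : k ≤ L) :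
    edgeValue Y L A B C D (L - k) ≤ edgeValue Y L B A D C k := by
  have := edgeValue_le (Y := Y) (L := L) (A := A) (B := B) (C := C) (D := D) (k := L - k)
  apply le_edgeValue <;> simp only [Nat.dist] at * <;> omega

theorem edgeValue_sub (hL : Y ≤ L) (hk : k ≤ L) :
    edgeValue Y L A B C D (L - k) = edgeValue Y L B A D C k := by
  refine (edgeValue_sub_le hL hk).antisymm ?_
  conv_lhs => rw [← Nat.sub_sub_self hk]
  exact edgeValue_sub_le hL (Nat.sub_le L k)

namespace EdgeCompatible

theorem edgeValue_zero (h : EdgeCompatible Y L A B C D) (hL : 2 * Y < L) :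
    edgeValue Y L A B C D 0 = A := by
  obtain ⟨h₁, h₂, h₃, -, -, -⟩ := h
  simp only [Nat.dist] at h₁ h₂ h₃
  refine le_antisymm edgeValue_le.1 (le_edgeValue ?_ ?_ ?_ ?_) <;> simp only [Nat.dist] <;> omega

theorem edgeValue_length (h : EdgeCompatible Y L A B C D) (hL : 2 * Y < L) :
    edgeValue Y L A B C D L = B := by
  obtain ⟨h₁, -, -, h₂, h₃, -⟩ := h
  simp only [Nat.dist] at h₁ h₂ h₃
  have hle : edgeValue Y L A B C D L ≤ _ := edgeValue_le.2.1
  rw [Nat.dist_self] at hle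
  refine hle.antisymm (le_edgeValue ?_ ?_ ?_ ?_) <;> simp only [Nat.dist] <;> omega

theorem dist_edgeValue_left (h : EdgeCompatible Y L A B C D) (hL : 2 * Y < L) :
    Nat.dist (edgeValue Y L A B C D Y) C ≤ Y := by
  obtain ⟨-, h₁, -, h₂, -, h₃⟩ := h
  have hle : edgeValue Y L A B C D Y ≤ _ := edgeValue_le.2.2.1
  have hge : C - Y ≤ edgeValue Y L A B C D Y := by
    apply le_edgeValue <;> simp only [Nat.dist] at * <;> omega
  simp only [Nat.dist] at *
  omega

theorem dist_edgeValue_right (h : EdgeCompatible Y L A B C D) (hL : 2 * Y < L) :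
    Nat.dist (edgeValue Y L A B C D (L - Y)) D ≤ Y := by
  obtain ⟨-, -, h₁, -, h₂, h₃⟩ := h
  have hle : edgeValue Y L A B C D (L - Y) ≤ _ := edgeValue_le.2.2.2
  have hge : D - Y ≤ edgeValue Y L A B C D (L - Y) := by
    apply le_edgeValue <;> simp only [Nat.dist] at * <;> omega
  simp only [Nat.dist] at *
  omega

end EdgeCompatible

theorem edgeValue_descent (hk : 0 < k ∧ k < L) :
    edgeValue Y L A B C D (k - 1) < edgeValue Y L A B C D k ∨
    edgeValue Y L A B C D (k + 1) < edgeValue Y L A B C D k ∨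
    (k = Y ∧ edgeValue Y L A B C D k = C + Y) ∨ (k = L - Y ∧ edgeValue Y L A B C D k = D + Y) := by
  obtain ⟨p, v, hx, ⟨-, h⟩ | ⟨-, h⟩ | ⟨rfl, h⟩⟩ := exists_mem_lowerEnvelope_descent
    (S := {(0, A), (L, B), (Y, C + Y), (L - Y, D + Y)}) (by simp) k
  · exact Or.inl h
  · exact Or.inr (Or.inl h)
  · rcases hx with ⟨rfl, rfl⟩ | ⟨rfl, rfl⟩ | ⟨rfl, rfl⟩ | ⟨rfl, rfl⟩
    · exact absurd hk.1 (lt_irrefl 0)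
    · exact absurd hk.2 (lt_irrefl _)
    · exact Or.inr (Or.inr (Or.inl ⟨rfl, h⟩))
    · exact Or.inr (Or.inr (Or.inr ⟨rfl, h⟩))

end EdgeValue

section Arithmetic

variable {n : ℕ}

theorem y_pos (hn : 0 < n) : 0 < y n := by
  rw [y]
  positivity

theorem exists_half_y (hn : 2 ≤ n) : ∃ h, y n = 2 * h ∧ 10 * n ≤ h :=
  ⟨5 * n ^ 2, by rw [y]; ring, by nlinarith⟩

theorem lt_y (hn : 0 < n) : n < y n := by
  rw [y]
  nlinarith

theorem mul_y_add_le {i j : Fin n} (hij : i < j) : i.val * y n + y n ≤ j.val * y n := by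
  rw [← Nat.succ_mul]
  exact Nat.mul_le_mul_right _ hij

theorem mul_y_le (i : Fin n) : i.val * y n ≤ (n - 1) * y n :=
  Nat.mul_le_mul_right _ (by omega)

theorem edgeLen_add {i j : Fin n} (hij : i < j) {h : ℕ} (hy : y n = 2 * h) :
    edgeLen i j + i.val * y n = j.val * y n + 3 * h := by
  have hmul : (j.val - i.val) * y n + i.val * y n = j.val * y n := by
    rw [← Nat.add_mul, Nat.sub_add_cancel (le_of_lt hij)]
  rw [edgeLen, show y n / 2 = h by omega]
  omega

theorem two_mul_y_lt_edgeLen {i j : Fin n} (hij : i < j) : 2 * y n < edgeLen i j := by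
  obtain ⟨h, hy, -⟩ := exists_half_y (n := n) (by omega)
  have := edgeLen_add hij hy
  have := mul_y_add_le hij
  have := y_pos (n := n) i.pos
  omega

end Arithmetic

/-- The distance along the path of the edge `ij` from `r^i_j` to the vertex `w_1` or `w_2` where the
left or right branch starts. -/
def branchFoot {n : ℕ} (i j : Fin n) : Side → ℕ
  | .left => y n
  | .right => edgeLen i j - y n

/-- The position on the top line of the end of the left or right branch of the edge `ij`. -/
def branchTop {n : ℕ} (i j : Fin n) : Side → ℕ
  | .left => i.val * y n + (j.val + 1)
  | .right => j.val * y n - (i.val + 1)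

section Branches

variable {n : ℕ} {i j : Fin n} (hij : i < j)

include hij

theorem branchFoot_mem_Ioo (s : Side) : 0 < branchFoot i j s ∧ branchFoot i j s < edgeLen i j := by
  have := two_mul_y_lt_edgeLen hij
  have := y_pos (n := n) i.pos
  cases s <;> simp only [branchFoot] <;> omega

theorem branchTop_le (s : Side) : branchTop i j s ≤ (n - 1) * y n := by
  have := mul_y_add_le hij
  have := mul_y_le j
  have := lt_y (n := n) i.pos
  cases s <;> simp only [branchTop] <;> omega

theorem branchTop_right_add : branchTop i j .right + (i.val + 1) = j.val * y n := by
  have := mul_y_add_le hij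
  have := lt_y (n := n) i.pos
  simp only [branchTop]
  omega

end Branches

section Steps

variable {n : ℕ} {H : SimpleGraph (Fin n)}

theorem Step.adj {u v : Vertex H} (h : Step H u v) : (reduction H).Adj u v := by
  rw [reduction, SimpleGraph.fromRel_adj]
  refine ⟨?_, Or.inl h⟩
  rintro rfl
  cases h
  omega

variable {i j : Fin n} (hij : i < j) (e : H.Adj i j)

theorem step_edgePath_branch (s : Side) (hk : 0 < branchFoot i j s ∧ branchFoot i j s < edgeLen i j)
    (h1 : 0 < 1 ∧ 1 < y n) :
    Step H (.edgePath i j hij e (branchFoot i j s) hk) (.branch s i j hij e 1 h1) := by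
  cases s
  · exact .edge_branch_left i j hij e _ hk h1 rfl
  · refine .edge_branch_right i j hij e _ hk h1 ?_
    have := two_mul_y_lt_edgeLen hij
    simp only [branchFoot]
    omega

theorem step_branch_line (s : Side) {k : ℕ} (hk : 0 < k ∧ k < y n) (hky : k + 1 = y n) :
    Step H (.branch s i j hij e k hk) (.line .top (branchTop i j s) (branchTop_le hij s)) := by
  cases s
  · exact .branch_left_line i j hij e k hk _ _ hky rfl
  · exact .branch_right_line i j hij e k hk _ _ hky (branchTop_right_add hij)

end Steps

/-- A function on the lines, the pending paths and the cycles of the construction. -/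
structure Profile (n : ℕ) where
  line : Row → ℕ → ℕ
  mid : Row → Side → ℕ
  leaf : Row → Side → Bool → ℕ
  anchor : Row → Fin n → ℕ
  arm : Side → Fin n → Fin n → ℕ

namespace Profile

variable {n : ℕ} {H : SimpleGraph (Fin n)}

/-- The value of the extension of a profile at position `k` of a `y`-path from an anchor to a
line. -/
noncomputable def spoke (φ : Profile n) (c : Row) (i : Fin n) : ℕ → ℕ :=
  pathValue (y n) (φ.anchor c i) (φ.line c (i.val * y n))

/-- The value of the extension of a profile at position `k` of the path of the edge `ij`. -/
noncomputable def edge (φ : Profile n) (i j : Fin n) : ℕ → ℕ :=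
  edgeValue (y n) (edgeLen i j) (φ.arm .right i j) (φ.arm .right j i)
    (φ.line .top (branchTop i j .left)) (φ.line .top (branchTop i j .right))

/-- The value of the extension of a profile at position `k` of a branch of the path of the edge
`ij`. -/
noncomputable def branch (φ : Profile n) (s : Side) (i j : Fin n) : ℕ → ℕ :=
  pathValue (y n) (φ.edge i j (branchFoot i j s)) (φ.line .top (branchTop i j s))

/-- The extension of a profile to all vertices; a profile of distances from a vertex extends to the
distances from that vertex. -/
noncomputable def ext (φ : Profile n) : Vertex H → ℕ
  | .line c p _ => φ.line c p
  | .pendMid c s => φ.mid c s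
  | .pendLeaf c s b => φ.leaf c s b
  | .anchor c i => φ.anchor c i
  | .arm s i j => φ.arm s i j
  | .spoke c i k _ => φ.spoke c i k
  | .edgePath i j _ _ k _ => φ.edge i j k
  | .branch s i j _ _ k _ => φ.branch s i j k

/-- The inequalities that make the extension of a profile `1`-Lipschitz. -/
structure IsLipschitz (φ : Profile n) (H : SimpleGraph (Fin n)) : Prop where
  line : ∀ c p, p + 1 ≤ (n - 1) * y n → Nat.dist (φ.line c p) (φ.line c (p + 1)) ≤ 1
  leaf : ∀ c s b, Nat.dist (φ.leaf c s b) (φ.mid c s) ≤ 1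
  mid_left : ∀ c, Nat.dist (φ.mid c .left) (φ.line c 0) ≤ 1
  mid_right : ∀ c, Nat.dist (φ.mid c .right) (φ.line c ((n - 1) * y n)) ≤ 1
  top_arm : ∀ s i (j : Fin n), j.val = 0 → Nat.dist (φ.anchor .top i) (φ.arm s i j) ≤ 1
  arm : ∀ s i (j j' : Fin n), j'.val = j.val + 1 → Nat.dist (φ.arm s i j) (φ.arm s i j') ≤ 1
  arm_bottom : ∀ s i (j : Fin n), j.val + 1 = n →
    Nat.dist (φ.arm s i j) (φ.anchor .bottom i) ≤ 1
  spoke : ∀ c (i : Fin n), Nat.dist (φ.anchor c i) (φ.line c (i.val * y n)) ≤ y n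
  edge : ∀ i j : Fin n, i < j → H.Adj i j →
    EdgeCompatible (y n) (edgeLen i j) (φ.arm .right i j) (φ.arm .right j i)
      (φ.line .top (branchTop i j .left)) (φ.line .top (branchTop i j .right))

namespace IsLipschitz

variable {φ : Profile n} {i j : Fin n}

theorem edge_zero (h : φ.IsLipschitz H) (hij : i < j) (e : H.Adj i j) :
    φ.edge i j 0 = φ.arm .right i j :=
  (h.edge i j hij e).edgeValue_zero (two_mul_y_lt_edgeLen hij)

theorem edge_length (h : φ.IsLipschitz H) (hij : i < j) (e : H.Adj i j) :
    φ.edge i j (edgeLen i j) = φ.arm .right j i :=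
  (h.edge i j hij e).edgeValue_length (two_mul_y_lt_edgeLen hij)

theorem dist_branchFoot (h : φ.IsLipschitz H) (hij : i < j) (e : H.Adj i j) (s : Side) :
    Nat.dist (φ.edge i j (branchFoot i j s)) (φ.line .top (branchTop i j s)) ≤ y n := by
  cases s
  · exact (h.edge i j hij e).dist_edgeValue_left (two_mul_y_lt_edgeLen hij)
  · exact (h.edge i j hij e).dist_edgeValue_right (two_mul_y_lt_edgeLen hij)

theorem dist_edge_branch (h : φ.IsLipschitz H) (hij : i < j) (e : H.Adj i j) (s : Side) :
    Nat.dist (φ.edge i j (branchFoot i j s)) (φ.branch s i j 1) ≤ 1 := by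
  have hstep : Nat.dist (φ.branch s i j 0) (φ.branch s i j 1) ≤ 1 := dist_pathValue_succ
  rwa [branch, pathValue_zero (h.dist_branchFoot hij e s)] at hstep

theorem dist_branch_line (h : φ.IsLipschitz H) (hij : i < j) (e : H.Adj i j) (s : Side) {k : ℕ}
    (hk : k + 1 = y n) : Nat.dist (φ.branch s i j k) (φ.line .top (branchTop i j s)) ≤ 1 := by
  have hstep : Nat.dist (φ.branch s i j k) (φ.branch s i j (k + 1)) ≤ 1 := dist_pathValue_succ
  rwa [hk, branch, pathValue_length (h.dist_branchFoot hij e s)] at hstep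

theorem dist_ext_step (h : φ.IsLipschitz H) {u v : Vertex H} (huv : Step H u v) :
    Nat.dist (φ.ext u) (φ.ext v) ≤ 1 := by
  cases huv with
  | line_line c p hp hp' => exact h.line c p hp'
  | leaf_mid c s b => exact h.leaf c s b
  | mid_left c hp => exact h.mid_left c
  | mid_right c hp => exact h.mid_right c
  | top_arm s i j hj => exact h.top_arm s i j hj
  | arm_arm s i j j' hj => exact h.arm s i j j' hj
  | arm_bottom s i j hj => exact h.arm_bottom s i j hj
  | anchor_spoke c i hk =>
    have hstep : Nat.dist (φ.spoke c i 0) (φ.spoke c i 1) ≤ 1 := dist_pathValue_succ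
    rwa [Profile.spoke, pathValue_zero (h.spoke c i)] at hstep
  | spoke_spoke c i k hk hk' => exact dist_pathValue_succ
  | spoke_line c i k hk p hp hky hp' =>
    subst hp'
    have hstep : Nat.dist (φ.spoke c i k) (φ.spoke c i (k + 1)) ≤ 1 := dist_pathValue_succ
    rwa [hky, Profile.spoke, pathValue_length (h.spoke c i)] at hstep
  | arm_edge i j hij e hk =>
    have hstep : Nat.dist (φ.edge i j 0) (φ.edge i j 1) ≤ 1 := dist_edgeValue_succ
    rwa [h.edge_zero hij e] at hstep
  | edge_edge i j hij e k hk hk' => exact dist_edgeValue_succ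
  | edge_arm i j hij e k hk hkL =>
    have hstep : Nat.dist (φ.edge i j k) (φ.edge i j (k + 1)) ≤ 1 := dist_edgeValue_succ
    rwa [hkL, h.edge_length hij e] at hstep
  | edge_branch_left i j hij e k hk hk' hky =>
    subst hky
    exact h.dist_edge_branch hij e .left
  | branch_left_line i j hij e k hk p hp hky hp' =>
    subst hp'
    exact h.dist_branch_line hij e .left hky
  | edge_branch_right i j hij e k hk hk' hky =>
    obtain rfl : k = branchFoot i j .right := Nat.eq_sub_of_add_eq hky
    exact h.dist_edge_branch hij e .right
  | branch_right_line i j hij e k hk p hp hky hp' =>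
    obtain rfl : p = branchTop i j .right := Nat.eq_sub_of_add_eq hp'
    exact h.dist_branch_line hij e .right hky
  | branch_branch s i j hij e k hk hk' => exact dist_pathValue_succ

theorem ext_le_add_one (h : φ.IsLipschitz H) (u v : Vertex H) (huv : (reduction H).Adj u v) :
    φ.ext u ≤ φ.ext v + 1 := by
  rw [reduction, SimpleGraph.fromRel_adj] at huv
  rcases huv.2 with hstep | hstep <;>
  · have := h.dist_ext_step hstep
    simp only [Nat.dist] at this
    omega

theorem exists_ext_lt_spoke (h : φ.IsLipschitz H) (c : Row) (i : Fin n) (k : ℕ)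
    (hk : 0 < k ∧ k < y n) :
    ∃ u : Vertex H, (reduction H).Adj u (.spoke c i k hk) ∧
      φ.ext u < φ.ext (.spoke c i k hk : Vertex H) := by
  obtain ⟨k, rfl⟩ : ∃ k', k = k' + 1 := ⟨k - 1, by omega⟩
  rcases pathValue_descent (A := φ.anchor c i) (B := φ.line c (i.val * y n)) hk with hlt | hlt
  · rw [Nat.add_sub_cancel] at hlt
    rcases Nat.eq_zero_or_pos k with rfl | hk0
    · exact ⟨.anchor c i, (Step.anchor_spoke c i hk).adj, by
        rwa [pathValue_zero (h.spoke c i)] at hlt⟩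
    · exact ⟨.spoke c i k ⟨hk0, by omega⟩, (Step.spoke_spoke c i k _ hk).adj, hlt⟩
  · rcases Nat.lt_or_eq_of_le (Nat.succ_le_of_lt hk.2) with hk1 | hk1
    · exact ⟨.spoke c i (k + 1 + 1) ⟨by omega, hk1⟩, (Step.spoke_spoke c i _ hk _).adj.symm, hlt⟩
    · refine ⟨.line c (i.val * y n) (mul_y_le i),
        (Step.spoke_line c i _ hk _ _ hk1 rfl).adj.symm, ?_⟩
      rwa [← Nat.succ_eq_add_one (k + 1), hk1, pathValue_length (h.spoke c i)] at hlt

theorem exists_ext_lt_branch (h : φ.IsLipschitz H) (s : Side) (i j : Fin n) (hij : i < j)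
    (e : H.Adj i j) (k : ℕ) (hk : 0 < k ∧ k < y n) :
    ∃ u : Vertex H, (reduction H).Adj u (.branch s i j hij e k hk) ∧
      φ.ext u < φ.ext (.branch s i j hij e k hk) := by
  obtain ⟨k, rfl⟩ : ∃ k', k = k' + 1 := ⟨k - 1, by omega⟩
  have hfoot := h.dist_branchFoot hij e s
  rcases pathValue_descent (A := φ.edge i j (branchFoot i j s))
    (B := φ.line .top (branchTop i j s)) hk with hlt | hlt
  · rw [Nat.add_sub_cancel] at hlt
    rcases Nat.eq_zero_or_pos k with rfl | hk0
    · refine ⟨.edgePath i j hij e _ (branchFoot_mem_Ioo hij s),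
        (step_edgePath_branch hij e s _ hk).adj, ?_⟩
      rwa [pathValue_zero hfoot] at hlt
    · exact ⟨.branch s i j hij e k ⟨hk0, by omega⟩,
        (Step.branch_branch s i j hij e k _ hk).adj, hlt⟩
  · rcases Nat.lt_or_eq_of_le (Nat.succ_le_of_lt hk.2) with hk1 | hk1
    · exact ⟨.branch s i j hij e (k + 1 + 1) ⟨by omega, hk1⟩,
        (Step.branch_branch s i j hij e _ hk _).adj.symm, hlt⟩
    · refine ⟨_, (step_branch_line hij e s hk hk1).adj.symm, ?_⟩
      rwa [← Nat.succ_eq_add_one (k + 1), hk1, pathValue_length hfoot] at hlt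

theorem exists_ext_lt_edgePath (h : φ.IsLipschitz H) (i j : Fin n) (hij : i < j) (e : H.Adj i j)
    (k : ℕ) (hk : 0 < k ∧ k < edgeLen i j) :
    ∃ u : Vertex H, (reduction H).Adj u (.edgePath i j hij e k hk) ∧
      φ.ext u < φ.ext (.edgePath i j hij e k hk) := by
  have hfoot : ∀ s, k = branchFoot i j s → φ.edge i j k = φ.line .top (branchTop i j s) + y n →
      ∃ u : Vertex H, (reduction H).Adj u (.edgePath i j hij e k hk) ∧
        φ.ext u < φ.ext (.edgePath i j hij e k hk) := by
    rintro s rfl hval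
    have hy : 1 < y n := by have := lt_y (n := n) i.pos; omega
    refine ⟨_, (step_edgePath_branch hij e s hk ⟨one_pos, hy⟩).adj.symm, ?_⟩
    rw [ext, ext, branch, pathValue_eq_min hy.le]
    omega
  rcases edgeValue_descent (Y := y n) (A := φ.arm .right i j) (B := φ.arm .right j i)
    (C := φ.line .top (branchTop i j .left)) (D := φ.line .top (branchTop i j .right)) hk
    with hlt | hlt | ⟨hk', hval⟩ | ⟨hk', hval⟩
  · obtain ⟨k, rfl⟩ : ∃ k', k = k' + 1 := ⟨k - 1, by omega⟩
    rcases Nat.eq_zero_or_pos k with rfl | hk0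
    · exact ⟨_, (Step.arm_edge i j hij e hk).adj, (h.edge_zero hij e).symm.trans_lt hlt⟩
    · exact ⟨_, (Step.edge_edge i j hij e k ⟨hk0, by omega⟩ hk).adj, hlt⟩
  · rcases Nat.lt_or_eq_of_le (Nat.succ_le_of_lt hk.2) with hk1 | hk1
    · exact ⟨_, (Step.edge_edge i j hij e k hk ⟨by omega, hk1⟩).adj.symm, hlt⟩
    · refine ⟨_, (Step.edge_arm i j hij e k hk hk1).adj.symm,
        (h.edge_length hij e).symm.trans_lt ?_⟩
      rwa [← hk1]
  · exact hfoot .left hk' hval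
  · exact hfoot .right hk' hval

end IsLipschitz

end Profile

instance : DecidableEq Row
  | .top, .top | .bottom, .bottom => isTrue rfl
  | .top, .bottom | .bottom, .top => isFalse nofun

instance : DecidableEq Side
  | .left, .left | .right, .right => isTrue rfl
  | .left, .right | .right, .left => isFalse nofun

section Corners

variable {n : ℕ} {H : SimpleGraph (Fin n)}

/-- The position of the left or right end of a line. -/
def endPos (n : ℕ) : Side → ℕ
  | .left => 0
  | .right => (n - 1) * y n

/-- The distance from position `p` of a line to its left or right end. -/
def endDist (n : ℕ) (s : Side) (p : ℕ) : ℕ := Nat.dist p (endPos n s)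

/-- The distance between two lines. -/
def lineDist (n : ℕ) (c c' : Row) : ℕ := if c = c' then 0 else 2 * y n + n + 1

/-- The distance from the line `c` to the anchors `c'` of the vertex gadgets. -/
def anchorDist (n : ℕ) (c c' : Row) : ℕ := if c = c' then y n else y n + n + 1

/-- The distance from the line `c` to the vertices of index `j` on the arms of the vertex
gadgets. -/
def armDist (n : ℕ) : Row → ℕ → ℕ
  | .top, j => y n + 1 + j
  | .bottom, j => y n + n - j

/-- The distances from the corner at the end `s` of the line `c`; the corner is the leaf `b₀`. -/
def cornerProfile (n : ℕ) (b₀ : Bool) (c : Row) (s : Side) : Profile n where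
  line c' p := 2 + lineDist n c c' + endDist n s p
  mid c' s' := if c = c' ∧ s = s' then 1 else 3 + lineDist n c c' + endDist n s (endPos n s')
  leaf c' s' b := if c = c' ∧ s = s' then if b = b₀ then 0 else 2 else
    4 + lineDist n c c' + endDist n s (endPos n s')
  anchor c' i := 2 + anchorDist n c c' + endDist n s (i.val * y n)
  arm _ i j := 2 + armDist n c j.val + endDist n s (i.val * y n)

theorem endPos_le (s : Side) : endPos n s ≤ (n - 1) * y n := by
  cases s <;> simp [endPos]

theorem exists_mul_y_eq_endPos (hn : 0 < n) (s : Side) : ∃ i : Fin n, i.val * y n = endPos n s := by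
  cases s
  · exact ⟨⟨0, hn⟩, Nat.zero_mul _⟩
  · exact ⟨⟨n - 1, by omega⟩, rfl⟩

theorem dist_add_endDist_le (s : Side) {a b p q d : ℕ} (h : Nat.dist a b + Nat.dist p q ≤ d) :
    Nat.dist (a + endDist n s p) (b + endDist n s q) ≤ d := by
  simp only [endDist, Nat.dist] at *
  omega

theorem dist_cornerProfile_mid_line (b₀ : Bool) (c c' : Row) (s s' : Side) :
    Nat.dist ((cornerProfile n b₀ c s).mid c' s')
      ((cornerProfile n b₀ c s).line c' (endPos n s')) ≤ 1 := by
  simp only [cornerProfile]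
  split_ifs with h
  · obtain ⟨rfl, rfl⟩ := h
    simp [lineDist, endDist, Nat.dist]
  · simp only [Nat.dist]
    omega

theorem cornerProfile_edgeCompatible (b₀ : Bool) (c : Row) (s : Side) {i j : Fin n} (hij : i < j) :
    EdgeCompatible (y n) (edgeLen i j) ((cornerProfile n b₀ c s).arm .right i j)
      ((cornerProfile n b₀ c s).arm .right j i)
      ((cornerProfile n b₀ c s).line .top (branchTop i j .left))
      ((cornerProfile n b₀ c s).line .top (branchTop i j .right)) := by
  obtain ⟨h, hy, hh⟩ := exists_half_y (n := n) (by omega)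
  have hL := edgeLen_add hij hy
  have hmul := mul_y_add_le hij
  have hpos := branchTop_right_add hij
  have hleft : branchTop i j .left = i.val * y n + (j.val + 1) := rfl
  cases c <;> constructor <;> refine dist_add_endDist_le s ?_ <;>
    simp only [armDist, lineDist, reduceCtorEq, if_true, if_false, Nat.dist] <;> omega

theorem cornerProfile_isLipschitz (hn : 0 < n) (b₀ : Bool) (c : Row) (s : Side) :
    (cornerProfile n b₀ c s).IsLipschitz H where
  line c' p _ := dist_add_endDist_le s (by simp only [Nat.dist]; omega)
  leaf c' s' b := by
    simp only [cornerProfile]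
    split_ifs <;> simp only [Nat.dist] <;> omega
  mid_left c' := dist_cornerProfile_mid_line b₀ c c' s .left
  mid_right c' := dist_cornerProfile_mid_line b₀ c c' s .right
  top_arm s' i j hj := by
    cases c <;>
      simp only [cornerProfile, anchorDist, armDist, reduceCtorEq, if_true, if_false, Nat.dist] <;>
      omega
  arm s' i j j' hj := by
    cases c <;> simp only [cornerProfile, armDist, Nat.dist] <;> omega
  arm_bottom s' i j hj := by
    cases c <;>
      simp only [cornerProfile, anchorDist, armDist, reduceCtorEq, if_true, if_false, Nat.dist] <;>
      omega
  spoke c' i := by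
    have := lt_y hn
    simp only [cornerProfile, anchorDist, lineDist, Nat.dist]
    split_ifs <;> omega
  edge i j hij _ := cornerProfile_edgeCompatible b₀ c s hij

section Descent

variable (b₀ : Bool) (c : Row) (s : Side)

theorem cornerProfile_exists_ext_lt_line (c' : Row) (p : ℕ) (hp : p ≤ (n - 1) * y n) (hn : 0 < n) :
    ∃ u : Vertex H, (reduction H).Adj u (.line c' p hp) ∧
      (cornerProfile n b₀ c s).ext u < (cornerProfile n b₀ c s).ext (.line c' p hp : Vertex H) := by
  have hs := endPos_le (n := n) s
  rcases lt_trichotomy p (endPos n s) with hlt | rfl | hlt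
  · refine ⟨_, (Step.line_line c' p hp (by omega)).adj.symm, ?_⟩
    simp only [Profile.ext, cornerProfile, endDist, Nat.dist]
    omega
  · by_cases hc : c = c'
    · subst hc
      refine ⟨.pendMid c s, ?_, by simp only [Profile.ext, cornerProfile, and_self, if_true]; omega⟩
      cases s
      · exact (Step.mid_left c hp).adj
      · exact (Step.mid_right c hp).adj
    · obtain ⟨i, hi⟩ := exists_mul_y_eq_endPos hn s
      have hy := lt_y hn
      refine ⟨_, (Step.spoke_line c' i (y n - 1) ⟨by omega, by omega⟩ _ hp (by omega) hi.symm).adj,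
        ?_⟩
      rw [Profile.ext, Profile.ext, Profile.spoke, pathValue_eq_min (Nat.sub_le _ _)]
      simp only [cornerProfile, anchorDist, lineDist, if_neg hc, hi]
      omega
  · obtain ⟨p, rfl⟩ : ∃ p', p = p' + 1 := ⟨p - 1, by omega⟩
    refine ⟨_, (Step.line_line c' p (by omega) hp).adj, ?_⟩
    simp only [Profile.ext, cornerProfile, endDist, Nat.dist]
    omega

theorem cornerProfile_exists_ext_lt_mid (c' : Row) (s' : Side) :
    ∃ u : Vertex H, (reduction H).Adj u (.pendMid c' s') ∧
      (cornerProfile n b₀ c s).ext u <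
        (cornerProfile n b₀ c s).ext (.pendMid c' s' : Vertex H) := by
  by_cases hcs : c = c' ∧ s = s'
  · refine ⟨_, (Step.leaf_mid c' s' b₀).adj, ?_⟩
    simp [Profile.ext, cornerProfile, hcs]
  · have hlt : (cornerProfile n b₀ c s).line c' (endPos n s') <
        (cornerProfile n b₀ c s).mid c' s' := by
      simp only [cornerProfile, if_neg hcs]
      omega
    cases s'
    · exact ⟨_, (Step.mid_left c' (Nat.zero_le _)).adj.symm, hlt⟩
    · exact ⟨_, (Step.mid_right c' le_rfl).adj.symm, hlt⟩

theorem cornerProfile_exists_ext_lt_leaf (c' : Row) (s' : Side) (b : Bool)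
    (hcs : ¬(c = c' ∧ s = s' ∧ b = b₀)) :
    ∃ u : Vertex H, (reduction H).Adj u (.pendLeaf c' s' b) ∧
      (cornerProfile n b₀ c s).ext u <
        (cornerProfile n b₀ c s).ext (.pendLeaf c' s' b : Vertex H) := by
  refine ⟨_, (Step.leaf_mid c' s' b).adj.symm, ?_⟩
  simp only [Profile.ext, cornerProfile]
  split_ifs with h hb
  · exact absurd ⟨h.1, h.2, hb⟩ hcs
  · exact one_lt_two
  · omega

theorem cornerProfile_exists_ext_lt_anchor (c' : Row) (i : Fin n) :
    ∃ u : Vertex H, (reduction H).Adj u (.anchor c' i) ∧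
      (cornerProfile n b₀ c s).ext u < (cornerProfile n b₀ c s).ext (.anchor c' i : Vertex H) := by
  have hn := i.pos
  have hy := lt_y hn
  by_cases hc : c = c'
  · refine ⟨_, (Step.anchor_spoke c' i ⟨one_pos, by omega⟩).adj.symm, ?_⟩
    rw [Profile.ext, Profile.ext, Profile.spoke, pathValue_eq_min (by omega)]
    simp only [cornerProfile, anchorDist, lineDist, if_pos hc]
    omega
  · cases c' <;> cases c <;> try exact absurd rfl hc
    · refine ⟨_, (Step.top_arm .right i ⟨0, hn⟩ rfl).adj.symm, ?_⟩
      simp [Profile.ext, cornerProfile, anchorDist, armDist]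
    · refine ⟨_, (Step.arm_bottom .right i ⟨n - 1, by omega⟩ (by simp; omega)).adj, ?_⟩
      simp [Profile.ext, cornerProfile, anchorDist, armDist]
      omega

theorem cornerProfile_exists_ext_lt_arm (s' : Side) (i j : Fin n) :
    ∃ u : Vertex H, (reduction H).Adj u (.arm s' i j) ∧
      (cornerProfile n b₀ c s).ext u < (cornerProfile n b₀ c s).ext (.arm s' i j : Vertex H) := by
  cases c
  · by_cases hj : j.val = 0
    · refine ⟨_, (Step.top_arm s' i j hj).adj, ?_⟩
      simp only [Profile.ext, cornerProfile, anchorDist, armDist, if_true]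
      omega
    · refine ⟨_, (Step.arm_arm s' i ⟨j.val - 1, by omega⟩ j (by simp; omega)).adj, ?_⟩
      simp only [Profile.ext, cornerProfile, armDist]
      omega
  · by_cases hj : j.val + 1 = n
    · refine ⟨_, (Step.arm_bottom s' i j hj).adj.symm, ?_⟩
      simp only [Profile.ext, cornerProfile, anchorDist, armDist, if_true]
      omega
    · refine ⟨_, (Step.arm_arm s' i j ⟨j.val + 1, by omega⟩ rfl).adj.symm, ?_⟩
      simp only [Profile.ext, cornerProfile, armDist]
      omega

end Descent

theorem edist_corner (hn : 0 < n) (b₀ : Bool) (c : Row) (s : Side) (v : Vertex H) :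
    (reduction H).edist (.pendLeaf c s b₀) v = (cornerProfile n b₀ c s).ext v := by
  have hφ := cornerProfile_isLipschitz (H := H) hn b₀ c s
  refine edist_eq_of_lipschitz_of_descent hφ.ext_le_add_one (by simp [Profile.ext, cornerProfile])
    (fun v => ?_) v
  cases v with
  | line c' p hp => exact Or.inr (cornerProfile_exists_ext_lt_line b₀ c s c' p hp hn)
  | pendMid c' s' => exact Or.inr (cornerProfile_exists_ext_lt_mid b₀ c s c' s')
  | pendLeaf c' s' b =>
    by_cases hcs : c = c' ∧ s = s' ∧ b = b₀
    · obtain ⟨rfl, rfl, rfl⟩ := hcs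
      exact Or.inl rfl
    · exact Or.inr (cornerProfile_exists_ext_lt_leaf b₀ c s c' s' b hcs)
  | anchor c' i => exact Or.inr (cornerProfile_exists_ext_lt_anchor b₀ c s c' i)
  | arm s' i j => exact Or.inr (cornerProfile_exists_ext_lt_arm b₀ c s s' i j)
  | spoke c' i k hk => exact Or.inr (hφ.exists_ext_lt_spoke c' i k hk)
  | edgePath i j hij e k hk => exact Or.inr (hφ.exists_ext_lt_edgePath i j hij e k hk)
  | branch s' i j hij e k hk => exact Or.inr (hφ.exists_ext_lt_branch s' i j hij e k hk)

end Corners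

section CornerDistances

variable {n h N X a b k t₁ t₂ t₃ t₄ X' a' b' k' : ℤ}

/-- The distances `t₁`, `t₂` from the two corners of the top line and `t₃`, `t₄` from the two
corners of the bottom line, all diminished by `2`, to the vertex at distance `k` from `r^a_b` on the
path from `r^a_b` to `r^b_a`. The corners of `t₁` and `t₃` are those on the side of the gadget `a`,
which is at distance `X` from that end of the lines of length `N`; the length of a `y`-path is
`2 * h`. -/
structure EdgeDists (n h N X a b k t₁ t₂ t₃ t₄ : ℤ) : Prop where
  near : 0 ≤ a ∧ a < n
  far : 0 ≤ b ∧ b < n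
  pos : 0 < k
  top_near : t₁ = X + b + 1 + min (2 * h + k) (max (4 * h - k) k)
  top_far : t₂ = N - X + min (2 * h + 1 + b + k) (3 * h + a + 1 - k)
  bottom_near : t₃ = X + 2 * h + n - b + k
  bottom_far : t₄ = N - X + min (2 * h + n - b + k) (5 * h + n - a - k)

/-- The distances of `EdgeDists` for the vertex at distance `k` from the start of the branch that
leaves the path from `r^a_b` to `r^b_a` near `r^a_b`. -/
structure BranchDists (n h N X a b k t₁ t₂ t₃ t₄ : ℤ) : Prop where
  near : 0 ≤ a ∧ a < n
  far : 0 ≤ b ∧ b < n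
  pos : 0 < k
  lt : k < 2 * h
  top_near : t₁ = X + b + 1 + 2 * h - k
  top_far : t₂ = N - X - b - 1 - k + min (2 * h) (h + a + b + 2 + 2 * k)
  bottom_near : t₃ = X + min (4 * h + n - b + k) (6 * h + n + b + 2 - k)
  bottom_far : t₄ = N - X + min (3 * h + n - a + k) (6 * h + n - b - k)

/-- The gadgets `a` and `a'` at the positions `X` and `X'` coincide or are at least a `y`-path
apart. -/
def Separated (h a a' X X' : ℤ) : Prop :=
  (a = a' ∧ X = X') ∨ a ≠ a' ∧ X + 2 * h ≤ X' ∨ a ≠ a' ∧ X' + 2 * h ≤ X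

/-- The linear regimes of the table `EdgeDists`, in the order of increasing `k`. -/
inductive EdgeZone (n h N X a b k t₁ t₂ t₄ : ℤ) : Prop
  | first (h₁ : t₁ = X + b + 1 + 2 * h + k) (h₂ : t₂ = N - X + 2 * h + 1 + b + k)
      (h₄ : t₄ = N - X + 2 * h + n - b + k) (hk : 2 * k ≤ h + a - b)
  | second (h₁ : t₁ = X + b + 1 + 2 * h + k) (h₂ : t₂ = N - X + 3 * h + a + 1 - k)
      (h₄ : t₄ = N - X + 2 * h + n - b + k) (hk : h + a - b ≤ 2 * k) (hk' : k ≤ h)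
  | third (h₁ : t₁ = X + b + 1 + 4 * h - k) (h₂ : t₂ = N - X + 3 * h + a + 1 - k)
      (h₄ : t₄ = N - X + 2 * h + n - b + k) (hk : h ≤ k) (hk' : 2 * k ≤ 3 * h + b - a)
  | fourth (h₁ : t₁ = X + b + 1 + 4 * h - k) (h₂ : t₂ = N - X + 3 * h + a + 1 - k)
      (h₄ : t₄ = N - X + 5 * h + n - a - k) (hk : 3 * h + b - a ≤ 2 * k) (hk' : k ≤ 2 * h)
  | fifth (h₁ : t₁ = X + b + 1 + k) (h₂ : t₂ = N - X + 3 * h + a + 1 - k)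
      (h₄ : t₄ = N - X + 5 * h + n - a - k) (hk : 2 * h ≤ k)

theorem EdgeDists.zone (hh : 10 * n ≤ h) (hv : EdgeDists n h N X a b k t₁ t₂ t₃ t₄) :
    EdgeZone n h N X a b k t₁ t₂ t₄ := by
  obtain ⟨ha, hb, -, h₁, h₂, -, h₄⟩ := hv
  subst h₁ h₂ h₄
  rcases le_total (2 * k) (h + a - b) with hk₁ | hk₁
  · apply EdgeZone.first <;> omega
  rcases le_total k h with hk₂ | hk₂
  · apply EdgeZone.second <;> omega
  rcases le_total (2 * k) (3 * h + b - a) with hk₃ | hk₃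
  · apply EdgeZone.third <;> omega
  rcases le_total k (2 * h) with hk₄ | hk₄
  · apply EdgeZone.fourth <;> omega
  · apply EdgeZone.fifth <;> omega

/-- The linear regimes of the table `BranchDists`, in the order of increasing `k`. -/
inductive BranchZone (n h N X a b k t₂ t₃ t₄ : ℤ) : Prop
  | first (h₂ : t₂ = N - X + h + a + 1 + k) (h₃ : t₃ = X + 4 * h + n - b + k)
      (h₄ : t₄ = N - X + 3 * h + n - a + k) (hk : 2 * k + a + b + 2 ≤ h)
  | second (h₂ : t₂ = N - X + 2 * h - b - 1 - k) (h₃ : t₃ = X + 4 * h + n - b + k)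
      (h₄ : t₄ = N - X + 3 * h + n - a + k) (hk : h ≤ 2 * k + a + b + 2) (hk' : k ≤ h + b + 1)
  | third (h₂ : t₂ = N - X + 2 * h - b - 1 - k) (h₃ : t₃ = X + 6 * h + n + b + 2 - k)
      (h₄ : t₄ = N - X + 3 * h + n - a + k) (hk : h + b + 1 ≤ k) (hk' : 2 * k ≤ 3 * h + a - b)
  | fourth (h₂ : t₂ = N - X + 2 * h - b - 1 - k) (h₃ : t₃ = X + 6 * h + n + b + 2 - k)
      (h₄ : t₄ = N - X + 6 * h + n - b - k) (hk : 3 * h + a - b ≤ 2 * k)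

theorem BranchDists.zone (hh : 10 * n ≤ h) (hv : BranchDists n h N X a b k t₁ t₂ t₃ t₄) :
    BranchZone n h N X a b k t₂ t₃ t₄ := by
  obtain ⟨ha, hb, -, -, -, h₂, h₃, h₄⟩ := hv
  subst h₂ h₃ h₄
  rcases le_total (2 * k + a + b + 2) h with hk₁ | hk₁
  · apply BranchZone.first <;> omega
  rcases le_total k (h + b + 1) with hk₂ | hk₂
  · apply BranchZone.second <;> omega
  rcases le_total (2 * k) (3 * h + a - b) with hk₃ | hk₃
  · apply BranchZone.third <;> omega
  · apply BranchZone.fourth <;> omega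

theorem EdgeDists.eq (hh : 10 * n ≤ h) (hX : Separated h a a' X X')
    (hv : EdgeDists n h N X a b k t₁ t₂ t₃ t₄) (hw : EdgeDists n h N X' a' b' k' t₁ t₂ t₃ t₄) :
    a = a' ∧ b = b' ∧ k = k' := by
  have hv' := hv.zone hh
  have hw' := hw.zone hh
  obtain ⟨ha, hb, hk, -, -, h₃, -⟩ := hv
  obtain ⟨ha', hb', hk', -, -, h₃', -⟩ := hw
  rcases hX with ⟨rfl, rfl⟩ | ⟨hne, hX⟩ | ⟨hne, hX⟩ <;> cases hv' <;> cases hw' <;>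
  first
  | (exfalso; linarith)
  | exact (hne (by linarith)).elim
  | (refine ⟨rfl, ?_, ?_⟩ <;> linarith)

theorem EdgeDists.not_mirror (hh : 10 * n ≤ h) (hX : Separated h a a' X (N - X'))
    (hv : EdgeDists n h N X a b k t₁ t₂ t₃ t₄) (hab : a < b)
    (hba : b' < a') (hk' : k' < 2 * h) :
    ¬EdgeDists n h N X' a' b' k' t₂ t₁ t₄ t₃ := by
  intro hw
  have hv' := hv.zone hh
  have hw' := hw.zone hh
  obtain ⟨ha, hb, hk, -, -, h₃, -⟩ := hv
  obtain ⟨ha', hb', hk', -, -, h₃', -⟩ := hw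
  rcases hX with ⟨rfl, hX⟩ | ⟨-, hX⟩ | ⟨-, hX⟩ <;> cases hv' <;> cases hw' <;>
  linarith

theorem EdgeDists.eq_branch (hh : 10 * n ≤ h) (hX : Separated h a a' X X')
    (hv : EdgeDists n h N X a b k t₁ t₂ t₃ t₄) (hw : BranchDists n h N X' a' b' k' t₁ t₂ t₃ t₄) :
    a = a' ∧ b' = b + 2 * k' ∧ k + k' = 2 * h := by
  have hv' := hv.zone hh
  have hw' := hw.zone hh
  obtain ⟨ha, hb, hk, -, -, h₃, -⟩ := hv
  obtain ⟨ha', hb', hk', hlt, h₁', -, -, -⟩ := hw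
  rcases hX with ⟨rfl, rfl⟩ | ⟨-, hX⟩ | ⟨-, hX⟩ <;> cases hv' <;> cases hw' <;>
  first
  | (exfalso; linarith)
  | (refine ⟨rfl, ?_, ?_⟩ <;> linarith)

theorem EdgeDists.not_branch_mirror (hh : 10 * n ≤ h) (hX : Separated h a a' X (N - X'))
    (hv : EdgeDists n h N X a b k t₁ t₂ t₃ t₄) : ¬BranchDists n h N X' a' b' k' t₂ t₁ t₄ t₃ := by
  intro hw
  have hv' := hv.zone hh
  have hw' := hw.zone hh
  obtain ⟨ha, hb, hk, -, -, h₃, -⟩ := hv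
  obtain ⟨ha', hb', hk', hlt, h₁', -, -, -⟩ := hw
  rcases hX with ⟨rfl, hX⟩ | ⟨-, hX⟩ | ⟨-, hX⟩ <;> cases hv' <;> cases hw' <;>
  linarith

theorem BranchDists.eq (hh : 10 * n ≤ h) (hX : Separated h a a' X X')
    (hv : BranchDists n h N X a b k t₁ t₂ t₃ t₄) (hw : BranchDists n h N X' a' b' k' t₁ t₂ t₃ t₄) :
    a = a' ∧ b = b' ∧ k = k' := by
  have hv' := hv.zone hh
  have hw' := hw.zone hh
  obtain ⟨ha, hb, hk, hlt, h₁, -, -, -⟩ := hv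
  obtain ⟨ha', hb', hk', hlt', h₁', -, -, -⟩ := hw
  rcases hX with ⟨rfl, rfl⟩ | ⟨-, hX⟩ | ⟨-, hX⟩ <;> cases hv' <;> cases hw' <;>
  first
  | (exfalso; linarith)
  | (refine ⟨rfl, ?_, ?_⟩ <;> linarith)

theorem BranchDists.not_mirror (hh : 10 * n ≤ h) (hX : Separated h a a' X (N - X'))
    (hv : BranchDists n h N X a b k t₁ t₂ t₃ t₄) : ¬BranchDists n h N X' a' b' k' t₂ t₁ t₄ t₃ := by
  intro hw
  have hv' := hv.zone hh
  have hw' := hw.zone hh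
  obtain ⟨ha, hb, hk, -, h₁, -, -, -⟩ := hv
  obtain ⟨ha', hb', hk', hlt', h₁', -, -, -⟩ := hw
  rcases hX with ⟨rfl, hX⟩ | ⟨-, hX⟩ | ⟨-, hX⟩ <;> cases hv' <;> cases hw' <;> linarith

theorem EdgeDists.lt_sum (hh : 10 * n ≤ h) (hv : EdgeDists n h N X a b k t₁ t₂ t₃ t₄) :
    2 * N + 8 * h + 2 * n + 2 < t₁ + t₂ + t₃ + t₄ := by
  have hv' := hv.zone hh
  obtain ⟨ha, hb, hk, -, -, h₃, -⟩ := hv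
  cases hv' <;> linarith

theorem BranchDists.lt_sum (hh : 10 * n ≤ h) (hv : BranchDists n h N X a b k t₁ t₂ t₃ t₄) :
    2 * N + 8 * h + 2 * n + 2 < t₁ + t₂ + t₃ + t₄ := by
  have hv' := hv.zone hh
  obtain ⟨ha, hb, hk, hlt, h₁, -, -, -⟩ := hv
  cases hv' <;> linarith

end CornerDistances

section EdgeGadgetValues

variable {n h G X a b k A B C D : ℕ}

theorem cast_edgeValue_top_near (hh : 10 * n ≤ h) (ha : a < n) (hb : b < n) (hG : 2 * h ≤ G)
    (hA : A = X + 2 * h + 1 + b) (hB : B = X + G + 2 * h + 1 + a) (hC : C = X + b + 1)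
    (hD : D + a + 1 = X + G) (hk : k ≤ G + h) :
    (edgeValue (2 * h) (G + 3 * h) A B C D k : ℤ) =
      X + b + 1 + min (2 * h + k : ℤ) (max (4 * h - k) k) :=
  cast_edgeValue_eq (by omega) (by omega) (by omega) (by omega) (by omega) (by omega)

theorem cast_edgeValue_top_far (hh : 10 * n ≤ h) (ha : a < n) (hb : b < n)
    (hA : A = X + G + 2 * h + 1 + b) (hB : B = X + 2 * h + 1 + a) (hC : C + b + 1 = X + G)
    (hD : D = X + a + 1) (hk : k ≤ G + h) :
    (edgeValue (2 * h) (G + 3 * h) A B C D k : ℤ) =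
      X + G + min (2 * h + 1 + b + k : ℤ) (3 * h + a + 1 - k) :=
  cast_edgeValue_eq (by omega) (by omega) (by omega) (by omega) (by omega) (by omega)

theorem cast_edgeValue_bottom_near (hh : 10 * n ≤ h) (ha : a < n)
    (hA : A + b = X + 2 * h + n) (hB : B + a = X + G + 2 * h + n)
    (hC : C = X + 4 * h + n + b + 2) (hD : D + a = X + G + 4 * h + n) (hk : k ≤ G + h) :
    (edgeValue (2 * h) (G + 3 * h) A B C D k : ℤ) = X + 2 * h + n - b + k :=
  cast_edgeValue_eq (by omega) (by omega) (by omega) (by omega) (by omega) (by omega)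

theorem cast_edgeValue_bottom_far (hh : 10 * n ≤ h) (ha : a < n) (hb : b < n)
    (hA : A + b = X + G + 2 * h + n) (hB : B + a = X + 2 * h + n)
    (hC : C + b = X + G + 4 * h + n) (hD : D = X + 4 * h + n + a + 2) (hk : k ≤ G + h) :
    (edgeValue (2 * h) (G + 3 * h) A B C D k : ℤ) =
      X + G + min (2 * h + n - b + k : ℤ) (5 * h + n - a - k) :=
  cast_edgeValue_eq (by omega) (by omega) (by omega) (by omega) (by omega) (by omega)

end EdgeGadgetValues

/-- The opposite side. -/
def Side.swap : Side → Side
  | .left => .right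
  | .right => .left

@[simp]
theorem Side.swap_swap (s : Side) : s.swap.swap = s := by
  cases s <;> rfl

theorem Side.eq_or_eq_swap (s t : Side) : s = t ∨ t = s.swap := by
  cases s <;> cases t <;> simp [Side.swap]

/-- The end of an edge `ij`, where `i < j`, on the given side. -/
def nearEnd {n : ℕ} (i j : Fin n) : Side → Fin n
  | .left => i
  | .right => j

/-- The distance from the end on the given side to position `k` of a path of length `L`. -/
def nearPos (L k : ℕ) : Side → ℕ
  | .left => k
  | .right => L - k

section CornerDistances

variable {n h : ℕ} {H : SimpleGraph (Fin n)}

/-- The distance from the corner at the end `s` of the line `c`, diminished by `2`; the corner is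
the leaf `β c s`. -/
noncomputable def cornerDist (β : Row → Side → Bool) (c : Row) (s : Side) (v : Vertex H) : ℤ :=
  (cornerProfile n (β c s) c s).ext v - 2

theorem endDist_add_endDist_swap (s : Side) {p : ℕ} (hp : p ≤ (n - 1) * y n) :
    endDist n s p + endDist n s.swap p = (n - 1) * y n := by
  cases s <;> simp only [endDist, endPos, Side.swap, Nat.dist] <;> omega

theorem nearPos_branchFoot_swap (i j : Fin n) (s : Side) :
    nearPos (edgeLen i j) (branchFoot i j s.swap) s = edgeLen i j - y n := by
  cases s <;> rfl

variable {i j : Fin n} (hij : i < j)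

include hij

theorem nearPos_branchFoot (s : Side) : nearPos (edgeLen i j) (branchFoot i j s) s = y n := by
  have := two_mul_y_lt_edgeLen hij
  cases s <;> simp only [nearPos, branchFoot]
  omega

theorem edge_eq_edgeValue (φ : Profile n) (s : Side) {k : ℕ} (hk : k ≤ edgeLen i j) :
    φ.edge i j k = edgeValue (y n) (edgeLen i j)
      (φ.arm .right (nearEnd i j s) (nearEnd i j s.swap))
      (φ.arm .right (nearEnd i j s.swap) (nearEnd i j s)) (φ.line .top (branchTop i j s))
      (φ.line .top (branchTop i j s.swap)) (nearPos (edgeLen i j) k s) := by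
  cases s
  · rfl
  · exact (edgeValue_sub (by have := two_mul_y_lt_edgeLen hij; omega) hk).symm

/-- `G` is the distance along the lines between the two gadgets of the edge, and `W` is the distance
from the gadget that is not on the side `s` to the other end of the lines. -/
theorem exists_gap (hy : y n = 2 * h) (hh : 10 * n ≤ h) (s : Side) : ∃ G W,
    2 * h ≤ G ∧ edgeLen i j = G + 3 * h ∧
    endDist n s ((nearEnd i j s).val * y n) + (G + W) = (n - 1) * y n ∧
    endDist n s.swap ((nearEnd i j s).val * y n) = G + W ∧
    endDist n s ((nearEnd i j s.swap).val * y n) = endDist n s ((nearEnd i j s).val * y n) + G ∧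
    endDist n s.swap ((nearEnd i j s.swap).val * y n) = W ∧
    endDist n s (branchTop i j s) =
      endDist n s ((nearEnd i j s).val * y n) + (nearEnd i j s.swap).val + 1 ∧
    endDist n s (branchTop i j s.swap) + (nearEnd i j s).val + 1 =
      endDist n s ((nearEnd i j s).val * y n) + G ∧
    endDist n s.swap (branchTop i j s) + (nearEnd i j s.swap).val + 1 = G + W ∧
    endDist n s.swap (branchTop i j s.swap) = W + (nearEnd i j s).val + 1 := by
  have hL := edgeLen_add hij hy
  have hIJ := mul_y_add_le hij
  have hJN := mul_y_le j
  refine ⟨j.val * y n - i.val * y n,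
    endDist n s.swap ((nearEnd i j s.swap).val * y n), ?_⟩
  cases s <;>
    simp only [endDist, endPos, nearEnd, Side.swap, branchTop, Nat.dist, true_and] <;> omega

theorem edgeDists_edgePath (hy : y n = 2 * h) (hh : 10 * n ≤ h) (β : Row → Side → Bool)
    (e : H.Adj i j) (s : Side) {k : ℕ} (hk : 0 < k ∧ k < edgeLen i j)
    (hks : nearPos (edgeLen i j) k s + y n ≤ edgeLen i j) :
    EdgeDists n h ((n - 1) * y n : ℕ) (endDist n s ((nearEnd i j s).val * y n))
      (nearEnd i j s).val (nearEnd i j s.swap).val (nearPos (edgeLen i j) k s)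
      (cornerDist β .top s (.edgePath i j hij e k hk : Vertex H))
      (cornerDist β .top s.swap (.edgePath i j hij e k hk : Vertex H))
      (cornerDist β .bottom s (.edgePath i j hij e k hk : Vertex H))
      (cornerDist β .bottom s.swap (.edgePath i j hij e k hk : Vertex H)) := by
  obtain ⟨G, W, hG, hL, hX, h₁, h₂, h₃, h₄, h₅, h₆, h₇⟩ := exists_gap hij hy hh s
  have hpos : 0 < nearPos (edgeLen i j) k s := by
    cases s <;> simp only [nearPos] <;> omega
  simp only [cornerDist, Profile.ext, edge_eq_edgeValue hij _ s hk.2.le, hy, hL, cornerProfile,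
    armDist, lineDist, if_true, if_false, reduceCtorEq] at *
  have ha := (nearEnd i j s).isLt
  have hb := (nearEnd i j s.swap).isLt
  refine ⟨by omega, by omega, by omega, ?_, ?_, ?_, ?_⟩
  · rw [cast_edgeValue_top_near (X := 2 + endDist n s ((nearEnd i j s).val * (2 * h))) hh ha hb]
    all_goals omega
  · rw [cast_edgeValue_top_far (X := 2 + W) (b := (nearEnd i j s.swap).val) hh ha]
    all_goals omega
  · rw [cast_edgeValue_bottom_near (X := 2 + endDist n s ((nearEnd i j s).val * (2 * h))) hh ha
      (b := (nearEnd i j s.swap).val)]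
    all_goals omega
  · rw [cast_edgeValue_bottom_far (X := 2 + W) hh ha hb]
    all_goals omega

theorem cornerDist_foot (hy : y n = 2 * h) (hh : 10 * n ≤ h) (β : Row → Side → Bool)
    (e : H.Adj i j) (s : Side) {v : Vertex H}
    (hv : v = .edgePath i j hij e (branchFoot i j s) (branchFoot_mem_Ioo hij s)) :
    cornerDist β .top s v =
      endDist n s ((nearEnd i j s).val * y n) + (nearEnd i j s.swap).val + 1 + 2 * h ∧
    cornerDist β .top s.swap v =
      endDist n s.swap ((nearEnd i j s).val * y n) + h + (nearEnd i j s).val + 1 ∧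
    cornerDist β .bottom s v =
      endDist n s ((nearEnd i j s).val * y n) + 4 * h + n - (nearEnd i j s.swap).val ∧
    cornerDist β .bottom s.swap v =
      endDist n s.swap ((nearEnd i j s).val * y n) + 3 * h + n - (nearEnd i j s).val := by
  have hN := endDist_add_endDist_swap s (mul_y_le (nearEnd i j s))
  have hL := two_mul_y_lt_edgeLen hij
  have hfoot := nearPos_branchFoot hij s
  obtain ⟨ha, hb, -, h₁, h₂, h₃, h₄⟩ :=
    edgeDists_edgePath hij hy hh β e s (branchFoot_mem_Ioo hij s) (by omega)
  rw [← hv] at h₁ h₂ h₃ h₄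
  rw [hfoot] at *
  refine ⟨?_, ?_, ?_, ?_⟩
  · rw [h₁, max_eq_right, min_eq_right] <;> omega
  · rw [h₂, min_eq_right] <;> omega
  · rw [h₃]
    omega
  · rw [h₄, min_eq_right] <;> omega

theorem branchDists_branch (hy : y n = 2 * h) (hh : 10 * n ≤ h) (β : Row → Side → Bool)
    (e : H.Adj i j) (s : Side) {k : ℕ} (hk : 0 < k ∧ k < y n) :
    BranchDists n h ((n - 1) * y n : ℕ) (endDist n s ((nearEnd i j s).val * y n))
      (nearEnd i j s).val (nearEnd i j s.swap).val k
      (cornerDist β .top s (.branch s i j hij e k hk : Vertex H))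
      (cornerDist β .top s.swap (.branch s i j hij e k hk : Vertex H))
      (cornerDist β .bottom s (.branch s i j hij e k hk : Vertex H))
      (cornerDist β .bottom s.swap (.branch s i j hij e k hk : Vertex H)) := by
  obtain ⟨G, W, -, -, hX, h₁, -, -, h₄, -, h₆, -⟩ := exists_gap hij hy hh s
  obtain ⟨m₁, m₂, m₃, m₄⟩ := cornerDist_foot hij hy hh β e s rfl
  simp only [cornerDist, Profile.ext, Profile.branch, pathValue_eq_min hk.2.le] at m₁ m₂ m₃ m₄ ⊢
  refine ⟨by omega, by omega, by omega, by omega, ?_, ?_, ?_, ?_⟩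
  · simp only [cornerProfile, lineDist, if_true] at m₁ ⊢
    omega
  · simp only [cornerProfile, lineDist, if_true] at m₂ ⊢
    omega
  · simp only [cornerProfile, lineDist, if_false, reduceCtorEq] at m₃ ⊢
    omega
  · simp only [cornerProfile, lineDist, if_false, reduceCtorEq] at m₄ ⊢
    omega

end CornerDistances

section Decoding

variable {n h : ℕ} {H : SimpleGraph (Fin n)}

theorem separated_same_side (hy : y n = 2 * h) (s : Side) (a a' : Fin n) :
    Separated h a.val a'.val (endDist n s (a.val * y n)) (endDist n s (a'.val * y n)) := by
  have ha := mul_y_le a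
  have ha' := mul_y_le a'
  rcases lt_trichotomy a a' with hlt | rfl | hlt
  · have := mul_y_add_le hlt
    refine Or.inr ?_
    cases s <;> simp only [endDist, endPos, Nat.dist] <;> omega
  · exact Or.inl ⟨rfl, rfl⟩
  · have := mul_y_add_le hlt
    refine Or.inr ?_
    cases s <;> simp only [endDist, endPos, Nat.dist] <;> omega

theorem separated_opposite_sides (hy : y n = 2 * h) (s : Side) (a a' : Fin n) :
    Separated h a.val a'.val (endDist n s (a.val * y n))
      (((n - 1) * y n : ℕ) - endDist n s.swap (a'.val * y n)) := by
  have hswap := endDist_add_endDist_swap s (mul_y_le a')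
  convert separated_same_side hy s a a' using 1
  omega

variable (hy : y n = 2 * h) (hh : 10 * n ≤ h) (β : Row → Side → Bool) {i j i' j' : Fin n}
  (hij : i < j) (e : H.Adj i j) (hij' : i' < j') (e' : H.Adj i' j') {k k' : ℕ}

include hy hh

theorem edgePath_branch_of_cornerDist_eq (hk : 0 < k ∧ k < edgeLen i j) (s : Side)
    (hk' : 0 < k' ∧ k' < y n)
    (heq : ∀ c t, cornerDist β c t (.edgePath i j hij e k hk : Vertex H) =
      cornerDist β c t (.branch s i' j' hij' e' k' hk')) :
    nearEnd i j s = nearEnd i' j' s ∧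
      (nearEnd i' j' s.swap).val = (nearEnd i j s.swap).val + 2 * k' ∧
      nearPos (edgeLen i j) k s + k' = y n := by
  have hw := branchDists_branch hij' hy hh β e' s hk'
  simp only [← heq] at hw
  by_cases hks : nearPos (edgeLen i j) k s + y n ≤ edgeLen i j
  · obtain ⟨h₁, h₂, h₃⟩ := (edgeDists_edgePath hij hy hh β e s hk hks).eq_branch (by omega)
      (separated_same_side hy s _ _) hw
    exact ⟨by omega, by omega, by omega⟩
  · have hks' : nearPos (edgeLen i j) k s.swap + y n ≤ edgeLen i j := by
      have := two_mul_y_lt_edgeLen hij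
      cases s <;> simp only [nearPos, Side.swap] at * <;> omega
    have hv := edgeDists_edgePath hij hy hh β e s.swap hk hks'
    have hX := separated_opposite_sides hy s.swap (nearEnd i j s.swap) (nearEnd i' j' s)
    rw [Side.swap_swap] at hv hX
    exact absurd hw (hv.not_branch_mirror (by omega) hX)

theorem edgePath_eq_of_cornerDist_eq (hk : 0 < k ∧ k < edgeLen i j)
    (hk' : 0 < k' ∧ k' < edgeLen i' j')
    (heq : ∀ c t, cornerDist β c t (.edgePath i j hij e k hk : Vertex H) =
      cornerDist β c t (.edgePath i' j' hij' e' k' hk')) :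
    i = i' ∧ j = j' ∧ k = k' := by
  have hv := fun s => edgeDists_edgePath hij hy hh β e s hk
  have hw := fun s => edgeDists_edgePath hij' hy hh β e' s hk'
  simp only [← heq] at hw
  have hL := two_mul_y_lt_edgeLen hij
  have hL' := two_mul_y_lt_edgeLen hij'
  have hlr := hv .left
  have hrr := hv .right
  have hlr' := hw .left
  have hrr' := hw .right
  simp only [nearEnd, nearPos, Side.swap] at hlr hrr hlr' hrr'
  by_cases hleft : k + y n ≤ edgeLen i j ∧ k' + y n ≤ edgeLen i' j'
  · have := (hlr hleft.1).eq (by omega) (separated_same_side hy .left i i') (hlr' hleft.2)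
    omega
  by_cases hright : y n ≤ k ∧ y n ≤ k'
  · have := (hrr (by omega)).eq (by omega) (separated_same_side hy .right j j') (hrr' (by omega))
    obtain ⟨rfl, rfl⟩ : i = i' ∧ j = j' := by omega
    omega
  by_cases hlast : k' + y n ≤ edgeLen i' j'
  · exact absurd (hrr (by omega)) ((hlr' hlast).not_mirror (by omega)
      (separated_opposite_sides hy .left i' j) (by omega) (by omega) (by omega))
  · exact absurd (hrr' (by omega)) ((hlr (by omega)).not_mirror (by omega)
      (separated_opposite_sides hy .left i j') (by omega) (by omega) (by omega))

theorem branch_eq_of_cornerDist_eq {s s' : Side} (hk : 0 < k ∧ k < y n) (hk' : 0 < k' ∧ k' < y n)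
    (heq : ∀ c t, cornerDist β c t (.branch s i j hij e k hk : Vertex H) =
      cornerDist β c t (.branch s' i' j' hij' e' k' hk')) :
    s = s' ∧ i = i' ∧ j = j' ∧ k = k' := by
  have hv := branchDists_branch hij hy hh β e s hk
  have hw := branchDists_branch hij' hy hh β e' s' hk'
  simp only [← heq] at hw
  rcases Side.eq_or_eq_swap s s' with rfl | rfl
  · obtain ⟨h₁, h₂, h₃⟩ := hv.eq (by omega) (separated_same_side hy s _ _) hw
    cases s <;> exact ⟨rfl, by simp only [nearEnd, Side.swap] at *; omega,
      by simp only [nearEnd, Side.swap] at *; omega, by omega⟩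
  · rw [Side.swap_swap] at hw
    exact absurd hw (hv.not_mirror (by omega) (separated_opposite_sides hy s _ _))

end Decoding

section Resolution

variable {n : ℕ} {H : SimpleGraph (Fin n)}

/-- The vertices of the lines and the vertex gadgets. -/
def IsLadder : Vertex H → Prop
  | .line _ _ _ | .anchor _ _ | .arm _ _ _ | .spoke _ _ _ _ => True
  | _ => False

/-- The vertices of the path that is attached to the end `s` of the line `c`. -/
def IsPendingAt (c : Row) (s : Side) : Vertex H → Prop
  | .pendMid c' s' | .pendLeaf c' s' _ => c = c' ∧ s = s'
  | _ => False

/-- The position of the projection of a vertex of a line or a vertex gadget to the lines. -/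
def column : Vertex H → ℕ
  | .line _ p _ => p
  | .anchor _ i | .arm _ i _ | .spoke _ i _ _ => i.val * y n
  | _ => 0

/-- The distance from a vertex of a line or a vertex gadget to the top line. -/
def depth : Vertex H → ℕ
  | .line c _ _ => lineDist n .top c
  | .anchor c _ => anchorDist n .top c
  | .arm _ _ j => y n + 1 + j
  | .spoke c _ k _ => if c = .top then y n - k else y n + n + 1 + k
  | _ => 0

theorem IsLadder.column_le {v : Vertex H} (hv : IsLadder v) : column v ≤ (n - 1) * y n := by
  cases v with
  | line c p hp => exact hp
  | anchor c i => exact mul_y_le i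
  | arm s i j => exact mul_y_le i
  | spoke c i k hk => exact mul_y_le i
  | _ => exact hv.elim

theorem IsLadder.cornerDist_eq (β : Row → Side → Bool) (s : Side) {v : Vertex H}
    (hv : IsLadder v) :
    cornerDist β .top s v = endDist n s (column v) + depth v ∧
      cornerDist β .bottom s v = endDist n s (column v) + (2 * y n + n + 1) - depth v := by
  cases v with
  | line c p hp =>
    cases c <;> simp only [cornerDist, Profile.ext, cornerProfile, column, depth, lineDist,
      reduceCtorEq, if_true, if_false] <;> omega
  | anchor c i =>
    cases c <;> simp only [cornerDist, Profile.ext, cornerProfile, column, depth, anchorDist,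
      reduceCtorEq, if_true, if_false] <;> omega
  | arm s i j =>
    simp only [cornerDist, Profile.ext, cornerProfile, column, depth, armDist]
    omega
  | spoke c i k hk =>
    cases c <;> simp only [cornerDist, Profile.ext, Profile.spoke, pathValue_eq_min hk.2.le,
      cornerProfile, column, depth, lineDist, anchorDist, reduceCtorEq, if_true, if_false] <;> omega
  | _ => exact hv.elim

/-- Two vertices are the left and right vertices of the same gadget at the same height. -/
def AreTwins (v w : Vertex H) : Prop :=
  ∃ s i j, v = .arm s i j ∧ w = .arm s.swap i j

theorem IsLadder.eq_or_areTwins {v w : Vertex H} (hn : 0 < n) (hv : IsLadder v) (hw : IsLadder w)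
    (hc : column v = column w) (hd : depth v = depth w) : v = w ∨ AreTwins v w := by
  have hy := y_pos hn
  have hcol {i j : Fin n} (h : i.val * y n = j.val * y n) : i = j :=
    Fin.ext (Nat.eq_of_mul_eq_mul_right hy h)
  cases v <;> cases w
  case line.line c p _ c' p' _ =>
    obtain rfl : p = p' := hc
    cases c <;> cases c' <;> simp [depth, lineDist] at hd ⊢
  case anchor.anchor c i c' i' =>
    obtain rfl := hcol hc
    have hcc : c = c' := by
      simp only [depth, anchorDist] at hd
      cases c <;> cases c' <;> simp only [reduceCtorEq, if_true, if_false] at hd ⊢ <;> omega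
    exact Or.inl (hcc ▸ rfl)
  case arm.arm s i j s' i' j' =>
    obtain rfl := hcol hc
    obtain rfl : j = j' := Fin.ext (Nat.add_left_cancel hd)
    rcases s.eq_or_eq_swap s' with rfl | rfl
    · exact Or.inl rfl
    · exact Or.inr ⟨s, i, j, rfl, rfl⟩
  case spoke.spoke c i k hk c' i' k' hk' =>
    obtain rfl := hcol hc
    have hk : c = c' ∧ k = k' := by
      simp only [depth] at hd
      cases c <;> cases c' <;>
        simp only [reduceCtorEq, if_true, if_false, true_and, false_and] at hd ⊢ <;> omega
    obtain ⟨rfl, rfl⟩ := hk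
    exact Or.inl rfl
  all_goals
    first
    | exact hv.elim
    | exact hw.elim
    | simp only [depth, lineDist, anchorDist] at hd
      split_ifs at hd <;> omega

/-- The sum of the distances from the four corners, diminished by `8`. -/
noncomputable def cornerSum (β : Row → Side → Bool) (v : Vertex H) : ℤ :=
  cornerDist β .top .left v + cornerDist β .top .right v + cornerDist β .bottom .left v +
    cornerDist β .bottom .right v

theorem cornerSum_eq (β : Row → Side → Bool) (s : Side) (v : Vertex H) :
    cornerSum β v = cornerDist β .top s v + cornerDist β .top s.swap v +
      cornerDist β .bottom s v + cornerDist β .bottom s.swap v := by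
  cases s <;> simp only [cornerSum, Side.swap]
  ring

theorem IsLadder.cornerSum_eq (β : Row → Side → Bool) {v : Vertex H} (hv : IsLadder v) :
    cornerSum β v = 2 * ((n - 1) * y n : ℕ) + 4 * y n + 2 * n + 2 := by
  have hcol := endDist_add_endDist_swap .left hv.column_le
  simp only [cornerSum, hv.cornerDist_eq β _]
  simp only [Side.swap] at hcol
  omega

theorem lt_cornerSum (β : Row → Side → Bool) {v : Vertex H} (hl : ¬IsLadder v)
    (hp : ∀ c s, ¬IsPendingAt c s v) :
    2 * ((n - 1) * y n : ℕ) + 4 * y n + 2 * n + 2 < cornerSum β v := by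
  cases v with
  | edgePath i j hij e k hk =>
    obtain ⟨h, hy, hh⟩ := exists_half_y (n := n) (by omega)
    have hlen := two_mul_y_lt_edgeLen hij
    obtain ⟨s, hs⟩ : ∃ s, nearPos (edgeLen i j) k s + y n ≤ edgeLen i j := by
      by_cases hleft : k + y n ≤ edgeLen i j
      · exact ⟨.left, hleft⟩
      · exact ⟨.right, by simp only [nearPos]; omega⟩
    have := (edgeDists_edgePath hij hy hh β e s hk hs).lt_sum (by omega)
    rw [cornerSum_eq β s]
    omega
  | branch s i j hij e k hk =>
    obtain ⟨h, hy, hh⟩ := exists_half_y (n := n) (by omega)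
    have := (branchDists_branch hij hy hh β e s hk).lt_sum (by omega)
    rw [cornerSum_eq β s]
    omega
  | pendMid c s => exact (hp c s ⟨rfl, rfl⟩).elim
  | pendLeaf c s b => exact (hp c s ⟨rfl, rfl⟩).elim
  | _ => exact (hl trivial).elim

theorem two_lt_cornerProfile_edge (b₀ : Bool) (c : Row) (s : Side) {i j : Fin n} (k : ℕ) :
    2 < (cornerProfile n b₀ c s).edge i j k := by
  have hy := y_pos i.pos
  have harm (i j : Fin n) : 2 < (cornerProfile n b₀ c s).arm .right i j := by
    cases c <;> simp only [cornerProfile, armDist] <;> omega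
  exact le_edgeValue (Nat.le_add_right_of_le (harm i j)) (Nat.le_add_right_of_le (harm j i))
    (by simp only [cornerProfile]; omega) (by simp only [cornerProfile]; omega)

theorem cornerDist_line_pos_or (β : Row → Side → Bool) (c : Row) (s : Side) {c' : Row} {p : ℕ}
    {hp : p ≤ (n - 1) * y n} :
    0 < cornerDist β c s (.line c' p hp : Vertex H) ∨ c = c' ∧ endDist n s p = 0 := by
  refine or_iff_not_imp_right.2 fun hend => ?_
  simp only [cornerDist, Profile.ext, cornerProfile, lineDist]
  split_ifs with hc
  · have : endDist n s p ≠ 0 := fun h0 => hend ⟨hc, h0⟩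
    omega
  · omega

theorem cornerDist_pos_or (β : Row → Side → Bool) (c : Row) (s : Side) {w : Vertex H}
    (hw : ¬IsPendingAt c s w) :
    0 < cornerDist β c s w ∨ ∃ p hp, w = .line c p hp ∧ endDist n s p = 0 := by
  cases w with
  | line c' p hp =>
    refine (cornerDist_line_pos_or β c s).imp_right ?_
    rintro ⟨rfl, hend⟩
    exact ⟨p, hp, rfl, hend⟩
  | anchor c' i =>
    have := y_pos i.pos
    left
    simp only [cornerDist, Profile.ext, cornerProfile, anchorDist]
    split_ifs <;> omega
  | arm s' i j =>
    left
    cases c <;> simp only [cornerDist, Profile.ext, cornerProfile, armDist] <;> omega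
  | spoke c' i k hk =>
    left
    simp only [cornerDist, Profile.ext, Profile.spoke, pathValue_eq_min hk.2.le, cornerProfile]
    omega
  | edgePath i j hij e k hk =>
    have := two_lt_cornerProfile_edge (β c s) c s (i := i) (j := j) k
    left
    simp only [cornerDist, Profile.ext]
    omega
  | branch s' i j hij e k hk =>
    have := two_lt_cornerProfile_edge (β c s) c s (i := i) (j := j) (branchFoot i j s')
    left
    simp only [cornerDist, Profile.ext, Profile.branch, pathValue_eq_min hk.2.le]
    simp only [cornerProfile] at *
    omega
  | pendMid c' s' =>
    left
    simp only [cornerDist, Profile.ext, cornerProfile]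
    rw [if_neg (show ¬(c = c' ∧ s = s') from hw)]
    omega
  | pendLeaf c' s' b =>
    left
    simp only [cornerDist, Profile.ext, cornerProfile]
    rw [if_neg (show ¬(c = c' ∧ s = s') from hw)]
    omega

theorem cornerDist_pendMid (β : Row → Side → Bool) (c : Row) (s : Side) :
    cornerDist β c s (.pendMid c s : Vertex H) = -1 := by
  simp [cornerDist, Profile.ext, cornerProfile]

theorem cornerDist_pendLeaf (β : Row → Side → Bool) (c : Row) (s : Side) (b : Bool) :
    cornerDist β c s (.pendLeaf c s b : Vertex H) = if b = β c s then -2 else 0 := by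
  simp only [cornerDist, Profile.ext, cornerProfile, and_self, if_true]
  split_ifs <;> rfl

theorem cornerDist_swap_line_lt_pendLeaf (β : Row → Side → Bool) (c : Row) (s : Side) (b : Bool)
    {p : ℕ} (hp : p ≤ (n - 1) * y n) (hend : endDist n s p = 0) :
    cornerDist β c s.swap (.line c p hp : Vertex H) <
      cornerDist β c s.swap (.pendLeaf c s b : Vertex H) := by
  obtain rfl : p = endPos n s := Nat.eq_of_dist_eq_zero hend
  have hs : s.swap ≠ s := by cases s <;> simp [Side.swap]
  simp only [cornerDist, Profile.ext, cornerProfile, hs, and_false, if_false]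
  omega

theorem IsPendingAt.eq (β : Row → Side → Bool) {c : Row} {s : Side} {v w : Vertex H}
    (hv : IsPendingAt c s v) (hw : IsPendingAt c s w)
    (heq : cornerDist β c s v = cornerDist β c s w) : v = w := by
  cases v <;> cases w
  case pendMid.pendMid =>
    obtain ⟨⟨rfl, rfl⟩, rfl, rfl⟩ := And.intro hv hw
    rfl
  case pendMid.pendLeaf =>
    obtain ⟨⟨rfl, rfl⟩, rfl, rfl⟩ := And.intro hv hw
    rw [cornerDist_pendMid, cornerDist_pendLeaf] at heq
    split_ifs at heq
    omega
  case pendLeaf.pendMid =>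
    obtain ⟨⟨rfl, rfl⟩, rfl, rfl⟩ := And.intro hv hw
    rw [cornerDist_pendMid, cornerDist_pendLeaf] at heq
    split_ifs at heq
    omega
  case pendLeaf.pendLeaf b _ _ b' =>
    obtain ⟨⟨rfl, rfl⟩, rfl, rfl⟩ := And.intro hv hw
    rw [cornerDist_pendLeaf, cornerDist_pendLeaf] at heq
    have hb : b = b' := by
      revert heq
      cases b <;> cases b' <;> cases β c s <;> simp
    rw [hb]
  all_goals first | exact hv.elim | exact hw.elim

theorem IsPendingAt.eq_of_cornerDist_eq (β : Row → Side → Bool) {c : Row} {s : Side}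
    {v w : Vertex H} (hv : IsPendingAt c s v)
    (heq : ∀ c s, cornerDist β c s v = cornerDist β c s w) : v = w := by
  by_cases hw : IsPendingAt c s w
  · exact hv.eq β hw (heq c s)
  have hcs := heq c s
  rcases cornerDist_pos_or β c s hw with hpos | ⟨p, hp, rfl, hend⟩
  · cases v with
    | pendMid =>
      obtain ⟨rfl, rfl⟩ := hv
      rw [cornerDist_pendMid] at hcs
      omega
    | pendLeaf =>
      obtain ⟨rfl, rfl⟩ := hv
      rw [cornerDist_pendLeaf] at hcs
      split_ifs at hcs <;> omega
    | _ => exact hv.elim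
  · cases v with
    | pendMid =>
      obtain ⟨rfl, rfl⟩ := hv
      simp [cornerDist, Profile.ext, cornerProfile, lineDist, hend] at hcs
    | pendLeaf =>
      obtain ⟨rfl, rfl⟩ := hv
      exact absurd (heq c s.swap) (cornerDist_swap_line_lt_pendLeaf β c s _ hp hend).ne'
    | _ => exact hv.elim

/-- The pairs of vertices in edge gadgets that no corner resolves. -/
inductive Exceptional : Vertex H → Vertex H → Prop
  | mk (s i j i' j' hij e hij' e' k hk k' hk') : nearEnd i j s = nearEnd i' j' s →
      (nearEnd i' j' s.swap).val = (nearEnd i j s.swap).val + 2 * k' →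
      nearPos (edgeLen i j) k s + k' = y n →
      Exceptional (.edgePath i j hij e k hk) (.branch s i' j' hij' e' k' hk')

theorem eq_or_exceptional (hn : 2 ≤ n) (β : Row → Side → Bool) {v w : Vertex H}
    (hlv : ¬IsLadder v) (hpv : ∀ c s, ¬IsPendingAt c s v) (hlw : ¬IsLadder w)
    (hpw : ∀ c s, ¬IsPendingAt c s w) (heq : ∀ c s, cornerDist β c s v = cornerDist β c s w) :
    v = w ∨ Exceptional v w ∨ Exceptional w v := by
  obtain ⟨h, hy, hh⟩ := exists_half_y hn
  cases v <;> cases w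
  case edgePath.edgePath =>
    obtain ⟨rfl, rfl, rfl⟩ := edgePath_eq_of_cornerDist_eq hy hh β _ _ _ _ _ _ heq
    exact Or.inl rfl
  case edgePath.branch =>
    obtain ⟨h₁, h₂, h₃⟩ := edgePath_branch_of_cornerDist_eq hy hh β _ _ _ _ _ _ _ heq
    exact Or.inr (Or.inl (.mk _ _ _ _ _ _ _ _ _ _ _ _ _ h₁ h₂ h₃))
  case branch.edgePath =>
    obtain ⟨h₁, h₂, h₃⟩ := edgePath_branch_of_cornerDist_eq hy hh β _ _ _ _ _ _ _
      fun c s => (heq c s).symm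
    exact Or.inr (Or.inr (.mk _ _ _ _ _ _ _ _ _ _ _ _ _ h₁ h₂ h₃))
  case branch.branch =>
    obtain ⟨rfl, rfl, rfl, rfl⟩ := branch_eq_of_cornerDist_eq hy hh β _ _ _ _ _ _ heq
    exact Or.inl rfl
  all_goals
    first
    | exact (hlv trivial).elim
    | exact (hlw trivial).elim
    | exact (hpv _ _ ⟨rfl, rfl⟩).elim
    | exact (hpw _ _ ⟨rfl, rfl⟩).elim

theorem eq_or_areTwins_or_exceptional (hn : 2 ≤ n) (β : Row → Side → Bool) {v w : Vertex H}
    (heq : ∀ c s, cornerDist β c s v = cornerDist β c s w) :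
    v = w ∨ AreTwins v w ∨ Exceptional v w ∨ Exceptional w v := by
  by_cases hpv : ∃ c s, IsPendingAt c s v
  · obtain ⟨c, s, hpv⟩ := hpv
    exact Or.inl (hpv.eq_of_cornerDist_eq β heq)
  by_cases hpw : ∃ c s, IsPendingAt c s w
  · obtain ⟨c, s, hpw⟩ := hpw
    exact Or.inl (hpw.eq_of_cornerDist_eq β fun c s => (heq c s).symm).symm
  push Not at hpv hpw
  have hsum : cornerSum β v = cornerSum β w := by simp only [cornerSum, heq]
  by_cases hlv : IsLadder v <;> by_cases hlw : IsLadder w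
  · have hleft := hlv.cornerDist_eq β .left
    have hleft' := hlw.cornerDist_eq β .left
    rw [heq, heq] at hleft
    simp only [endDist, endPos, Nat.dist_zero_right] at hleft hleft'
    exact (hlv.eq_or_areTwins (by omega) hlw (by omega) (by omega)).imp_right Or.inl
  · exact absurd hsum ((hlv.cornerSum_eq β).trans_lt (lt_cornerSum β hlw hpw)).ne
  · exact absurd hsum ((hlw.cornerSum_eq β).trans_lt (lt_cornerSum β hlv hpv)).ne'
  · exact (eq_or_exceptional hn β hlv hpv hlw hpw heq).imp_right Or.inr

end Resolution

/-- A function on the cycle of a vertex gadget that is `1`-Lipschitz and bounded by `2 * n`. -/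
structure CycleFun (n : ℕ) where
  anchor : Row → ℕ
  arm : Side → Fin n → ℕ
  top_arm : ∀ s (j : Fin n), j.val = 0 → Nat.dist (anchor .top) (arm s j) ≤ 1
  arm_arm : ∀ s (j j' : Fin n), j'.val = j.val + 1 → Nat.dist (arm s j) (arm s j') ≤ 1
  arm_bottom : ∀ s (j : Fin n), j.val + 1 = n → Nat.dist (arm s j) (anchor .bottom) ≤ 1
  anchor_le : ∀ c, anchor c ≤ 2 * n
  arm_le : ∀ s j, arm s j ≤ 2 * n

namespace CycleFun

variable {n : ℕ}

/-- The zero function on a cycle; it measures the distance to a whole vertex gadget. -/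
def zero (n : ℕ) : CycleFun n where
  anchor _ := 0
  arm _ _ := 0
  top_arm _ _ _ := by simp only [Nat.dist_self, zero_le]
  arm_arm _ _ _ _ := by simp only [Nat.dist_self, zero_le]
  arm_bottom _ _ _ := by simp only [Nat.dist_self, zero_le]
  anchor_le _ := Nat.zero_le _
  arm_le _ _ := Nat.zero_le _

/-- The distance on a cycle to the two vertices at height `j`. -/
def height (j : Fin n) : CycleFun n where
  anchor
    | .top => j.val + 1
    | .bottom => n - j.val
  arm _ t := Nat.dist t.val j.val
  top_arm _ t ht := by simp only [Nat.dist, ht]; omega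
  arm_arm _ t t' ht := by simp only [Nat.dist, ht]; omega
  arm_bottom _ t ht := by simp only [Nat.dist]; omega
  anchor_le c := by cases c <;> simp only <;> omega
  arm_le _ t := by simp only [Nat.dist]; omega

/-- The distance on a cycle to the left vertex at height `j`. -/
def toLeft (j : Fin n) : CycleFun n where
  anchor
    | .top => j.val + 1
    | .bottom => n - j.val
  arm
    | .left, t => Nat.dist t.val j.val
    | .right, t => min (j.val + t.val + 2) (2 * n - j.val - t.val)
  top_arm s t ht := by cases s <;> simp only [Nat.dist, ht] <;> omega
  arm_arm s t t' ht := by cases s <;> simp only [Nat.dist, ht] <;> omega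
  arm_bottom s t ht := by cases s <;> simp only [Nat.dist] <;> omega
  anchor_le c := by cases c <;> simp only <;> omega
  arm_le s t := by cases s <;> simp only [Nat.dist] <;> omega

end CycleFun

/-- For `y n = 2 * h`, a lower bound for the distance to a set in the `i`-th vertex gadget, in terms
of the function `q` on the cycle of that gadget. It is exact on the route from the gadget of `α` to
the gadget of `i` through the edge gadget of `αi`. -/
def gadgetProfile {n : ℕ} (h : ℕ) (i α : Fin n) (q : CycleFun n) : Profile n where
  line _ p := Nat.dist p (i.val * y n) + 2 * h
  mid _ s := Nat.dist (endPos n s) (i.val * y n) + 2 * h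
  leaf _ s _ := Nat.dist (endPos n s) (i.val * y n) + 2 * h
  anchor c k := if k = i then q.anchor c else
    if k = α then Nat.dist (α.val * y n) (i.val * y n) + 3 * h + q.arm .right α +
      match c with | .top => i.val + 1 | .bottom => n - i.val
    else Nat.dist (k.val * y n) (i.val * y n) + 3 * h
  arm s k t := if k = i then q.arm s t else
    if k = α then
      Nat.dist (α.val * y n) (i.val * y n) + 3 * h + q.arm .right α + Nat.dist t.val i.val
    else Nat.dist (k.val * y n) (i.val * y n) + 3 * h

section Compatibility

theorem EdgeCompatible.symm {Y L A B C D : ℕ} (h : EdgeCompatible Y L A B C D) :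
    EdgeCompatible Y L B A D C where
  ends := by rw [Nat.dist_comm]; exact h.ends
  near_left := h.near_right
  far_left := h.far_right
  far_right := h.far_left
  near_right := h.near_left
  feet := by rw [Nat.dist_comm]; exact h.feet

variable {h m G A B c d : ℕ} (hh : 10 * m ≤ h) (hG : 2 * h ≤ G)

include hh hG

theorem edgeCompatible_of_near_end (hc : c ≤ m) (hd : d ≤ m) (hA : A ≤ 2 * m)
    (hB : G + 3 * h ≤ B) (hB' : B ≤ G + 3 * h + A) :
    EdgeCompatible (2 * h) (G + 3 * h) A B (c + 2 * h) (G - d + 2 * h) := by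
  constructor <;> simp only [Nat.dist] <;> omega

theorem edgeCompatible_of_far_ends {x x' : ℕ} (hx : Nat.dist x x' ≤ G)
    (hA : x + 3 * h ≤ A) (hA' : A ≤ x + 3 * h + 3 * m)
    (hB : x' + 3 * h ≤ B) (hB' : B ≤ x' + 3 * h + 3 * m)
    (hc : Nat.dist c x ≤ m) (hd : Nat.dist d x' ≤ m) :
    EdgeCompatible (2 * h) (G + 3 * h) A B (c + 2 * h) (d + 2 * h) := by
  simp only [Nat.dist] at hx hc hd
  constructor <;> simp only [Nat.dist] <;> omega

end Compatibility

section GadgetProfile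

variable {n h : ℕ} {i α : Fin n} (q : CycleFun n)

theorem gadgetProfile_line (h : ℕ) (i α : Fin n) (q : CycleFun n) (c : Row) (p : ℕ) :
    (gadgetProfile h i α q).line c p = Nat.dist p (i.val * y n) + 2 * h :=
  rfl

theorem gadgetProfile_arm_self (h : ℕ) (i α : Fin n) (q : CycleFun n) (s : Side) (t : Fin n) :
    (gadgetProfile h i α q).arm s i t = q.arm s t :=
  if_pos rfl

theorem gadgetProfile_arm_far (h : ℕ) (i α : Fin n) (q : CycleFun n) (s : Side) {k : Fin n}
    (hk : k ≠ i) : (gadgetProfile h i α q).arm s k i =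
      Nat.dist (k.val * y n) (i.val * y n) + 3 * h + if k = α then q.arm .right α else 0 := by
  simp only [gadgetProfile, if_neg hk, Nat.dist_self, Nat.add_zero]
  split_ifs with hα
  · rw [hα]
  · rfl

theorem gadgetProfile_arm_bounds (h : ℕ) (i α : Fin n) (q : CycleFun n) (s : Side) {k : Fin n}
    (hk : k ≠ i) (t : Fin n) :
    Nat.dist (k.val * y n) (i.val * y n) + 3 * h ≤ (gadgetProfile h i α q).arm s k t ∧
      (gadgetProfile h i α q).arm s k t ≤
        Nat.dist (k.val * y n) (i.val * y n) + 3 * h + 3 * n := by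
  have hq := q.arm_le .right α
  have ht : Nat.dist t.val i.val ≤ n := by simp only [Nat.dist]; omega
  simp only [gadgetProfile, if_neg hk]
  split_ifs with hα
  · subst hα
    omega
  · omega

theorem edgeLen_eq {a b : Fin n} (hab : a < b) (hy : y n = 2 * h) :
    edgeLen a b = b.val * y n - a.val * y n + 3 * h := by
  have := edgeLen_add hab hy
  have := mul_y_add_le hab
  omega

theorem gadgetProfile_dist_spoke (hy : y n = 2 * h) (hh : 10 * n ≤ h) (c : Row) (k : Fin n) :
    Nat.dist ((gadgetProfile h i α q).anchor c k) ((gadgetProfile h i α q).line c (k.val * y n)) ≤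
      y n := by
  have := q.anchor_le c
  have := q.arm_le .right α
  simp only [gadgetProfile]
  split_ifs with hki hkα
  · simp only [hki, Nat.dist]
    omega
  · subst hkα
    generalize Nat.dist (k.val * y n) (i.val * y n) = x
    cases c <;> simp only [Nat.dist] <;> omega
  · generalize Nat.dist (k.val * y n) (i.val * y n) = x
    simp only [Nat.dist]
    omega

section EdgeEnds

variable {a b : Fin n} (hab : a < b) (s : Side)

include hab

theorem nearEnd_swap_ne : nearEnd a b s.swap ≠ nearEnd a b s := by
  cases s
  · exact hab.ne'
  · exact hab.ne

theorem dist_branchTop_nearEnd :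
    Nat.dist (branchTop a b s) ((nearEnd a b s).val * y n) = (nearEnd a b s.swap).val + 1 := by
  have := mul_y_add_le hab
  have := lt_y a.pos
  cases s <;> simp only [branchTop, nearEnd, Side.swap, Nat.dist] <;> omega

theorem dist_branchTop_swap_nearEnd :
    Nat.dist (branchTop a b s.swap) ((nearEnd a b s).val * y n) =
      b.val * y n - a.val * y n - ((nearEnd a b s).val + 1) := by
  have := mul_y_add_le hab
  have := lt_y a.pos
  cases s <;> simp only [branchTop, nearEnd, Side.swap, Nat.dist] <;> omega

theorem dist_nearEnd_swap :
    Nat.dist ((nearEnd a b s.swap).val * y n) ((nearEnd a b s).val * y n) =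
      b.val * y n - a.val * y n := by
  have := mul_y_add_le hab
  cases s <;> simp only [nearEnd, Side.swap, Nat.dist] <;> omega

end EdgeEnds

theorem gadgetProfile_edgeCompatible_near (hy : y n = 2 * h) (hh : 10 * n ≤ h) {a b : Fin n}
    (hab : a < b) (s : Side) (hi : nearEnd a b s = i) :
    EdgeCompatible (y n) (edgeLen a b)
      ((gadgetProfile h i α q).arm .right (nearEnd a b s) (nearEnd a b s.swap))
      ((gadgetProfile h i α q).arm .right (nearEnd a b s.swap) (nearEnd a b s))
      ((gadgetProfile h i α q).line .top (branchTop a b s))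
      ((gadgetProfile h i α q).line .top (branchTop a b s.swap)) := by
  subst hi
  have hgap := mul_y_add_le hab
  have hG : 2 * h ≤ b.val * y n - a.val * y n := by omega
  rw [gadgetProfile_arm_self, gadgetProfile_arm_far h _ α q .right (nearEnd_swap_ne hab s),
    gadgetProfile_line, gadgetProfile_line, dist_branchTop_nearEnd hab,
    dist_branchTop_swap_nearEnd hab, dist_nearEnd_swap hab, edgeLen_eq hab hy]
  generalize b.val * y n - a.val * y n = G at *
  rw [hy]
  refine edgeCompatible_of_near_end hh hG (nearEnd a b s.swap).isLt (nearEnd a b s).isLt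
    (q.arm_le _ _) (Nat.le_add_right _ _) (Nat.add_le_add_left ?_ _)
  split_ifs with hα
  · rw [hα]
  · exact Nat.zero_le _

theorem gadgetProfile_edgeCompatible (hy : y n = 2 * h) (hh : 10 * n ≤ h) {a b : Fin n}
    (hab : a < b) :
    EdgeCompatible (y n) (edgeLen a b) ((gadgetProfile h i α q).arm .right a b)
      ((gadgetProfile h i α q).arm .right b a)
      ((gadgetProfile h i α q).line .top (branchTop a b .left))
      ((gadgetProfile h i α q).line .top (branchTop a b .right)) := by
  by_cases hai : a = i
  · exact gadgetProfile_edgeCompatible_near q hy hh hab .left hai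
  by_cases hbi : b = i
  · exact (gadgetProfile_edgeCompatible_near q hy hh hab .right hbi).symm
  have hgap := mul_y_add_le hab
  obtain ⟨hA, hA'⟩ := gadgetProfile_arm_bounds h i α q .right hai b
  obtain ⟨hB, hB'⟩ := gadgetProfile_arm_bounds h i α q .right hbi a
  rw [edgeLen_eq hab hy, gadgetProfile_line, gadgetProfile_line, branchTop, branchTop]
  generalize a.val * y n = P at *
  generalize b.val * y n = Q at *
  generalize i.val * y n = I at *
  rw [hy]
  refine edgeCompatible_of_far_ends hh (by omega) ?_ hA hA' hB hB' ?_ ?_ <;>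
    simp only [Nat.dist] <;> omega

theorem gadgetProfile_isLipschitz {H : SimpleGraph (Fin n)} (hy : y n = 2 * h)
    (hh : 10 * n ≤ h) : (gadgetProfile h i α q).IsLipschitz H where
  line c p _ := by simp only [gadgetProfile, Nat.dist]; omega
  leaf c s b := by simp only [gadgetProfile, Nat.dist_self, zero_le]
  mid_left c := by simp only [gadgetProfile, endPos, Nat.dist_self, zero_le]
  mid_right c := by simp only [gadgetProfile, endPos, Nat.dist_self, zero_le]
  top_arm s k j hj := by
    simp only [gadgetProfile]
    split_ifs
    · exact q.top_arm s j hj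
    · simp only [Nat.dist, hj]
      omega
    · simp only [Nat.dist_self, zero_le]
  arm s k j j' hj := by
    simp only [gadgetProfile]
    split_ifs
    · exact q.arm_arm s j j' hj
    · simp only [Nat.dist, hj]
      omega
    · simp only [Nat.dist_self, zero_le]
  arm_bottom s k j hj := by
    simp only [gadgetProfile]
    split_ifs
    · exact q.arm_bottom s j hj
    · simp only [Nat.dist]
      omega
    · simp only [Nat.dist_self, zero_le]
  spoke := gadgetProfile_dist_spoke q hy hh
  edge _ _ hab _ := gadgetProfile_edgeCompatible q hy hh hab

theorem gadgetProfile_le_edist {H : SimpleGraph (Fin n)} (hy : y n = 2 * h) (hh : 10 * n ≤ h)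
    {q : CycleFun n} {s : Side} {t : Fin n} (ht : q.arm s t = 0) (v : Vertex H) :
    ((gadgetProfile h i α q).ext v : ℕ∞) ≤ (reduction H).edist (.arm s i t) v :=
  le_edist_of_lipschitz (r := .arm s i t) (gadgetProfile_isLipschitz q hy hh).ext_le_add_one
    ((gadgetProfile_arm_self h i α q s t).trans ht) v

end GadgetProfile

section IsolatedVertex

variable {n : ℕ} {H : SimpleGraph (Fin n)}

/-- The length of the walk from `r^m_1` to a vertex of the top line or of a branch that leaves the
`m`-th vertex gadget through its top anchor and follows the top line. -/
def topWalkLength (m : Fin n) : Vertex H → ℕ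
  | .anchor _ _ => 1
  | .spoke _ _ k _ => 1 + k
  | .line _ p _ => 1 + y n + Nat.dist p (m.val * y n)
  | .branch s i j _ _ k _ => 1 + y n + Nat.dist (branchTop i j s) (m.val * y n) + (y n - k)
  | _ => 0

/-- The vertices that lie on a walk from `r^m_1` through the top anchor and along the top line to a
branch. -/
inductive OnTopWalk (m : Fin n) : Vertex H → Prop
  | start : OnTopWalk m (rFirst H m)
  | anchor : OnTopWalk m (.anchor .top m)
  | spoke (k hk) : OnTopWalk m (.spoke .top m k hk)
  | line (p hp) : OnTopWalk m (.line .top p hp)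
  | branch (s i j hij e k hk) : OnTopWalk m (.branch s i j hij e k hk)

theorem OnTopWalk.exists_lt {m : Fin n} {v : Vertex H} (hv : OnTopWalk m v) :
    v = rFirst H m ∨ ∃ u : Vertex H, OnTopWalk m u ∧ (reduction H).Adj u v ∧
      topWalkLength m u < topWalkLength m v := by
  have hy := lt_y m.pos
  have hnpos := m.pos
  cases hv with
  | start => exact Or.inl rfl
  | anchor => exact Or.inr ⟨_, .start, (Step.top_arm .right m ⟨0, m.pos⟩ rfl).adj.symm, one_pos⟩
  | spoke k hk =>
    right
    obtain ⟨k, rfl⟩ : ∃ k', k = k' + 1 := ⟨k - 1, by omega⟩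
    rcases Nat.eq_zero_or_pos k with rfl | hk0
    · exact ⟨_, .anchor, (Step.anchor_spoke .top m hk).adj, Nat.lt_succ_self 1⟩
    · exact ⟨_, .spoke k ⟨hk0, by omega⟩, (Step.spoke_spoke .top m k _ hk).adj,
        Nat.lt_succ_self (1 + k)⟩
  | line p hp =>
    right
    rcases lt_trichotomy p (m.val * y n) with hpm | rfl | hpm
    · have := mul_y_le m
      exact ⟨_, .line (p + 1) (by omega), (Step.line_line .top p hp _).adj.symm, by
        simp only [topWalkLength, Nat.dist]; omega⟩
    · exact ⟨_, .spoke (y n - 1) ⟨by omega, by omega⟩,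
        (Step.spoke_line .top m _ _ _ hp (by omega) rfl).adj, by
        simp only [topWalkLength]; omega⟩
    · obtain ⟨p, rfl⟩ : ∃ p', p = p' + 1 := ⟨p - 1, by omega⟩
      exact ⟨_, .line p (by omega), (Step.line_line .top p _ hp).adj, by
        simp only [topWalkLength, Nat.dist]; omega⟩
  | branch s i j hij e k hk =>
    right
    rcases Nat.lt_or_eq_of_le (Nat.succ_le_of_lt hk.2) with hk1 | hk1
    · exact ⟨_, .branch s i j hij e (k + 1) ⟨by omega, hk1⟩,
        (Step.branch_branch s i j hij e k hk _).adj.symm, by simp only [topWalkLength]; omega⟩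
    · exact ⟨_, .line _ (branchTop_le hij s), (step_branch_line hij e s hk hk1).adj.symm, by
        simp only [topWalkLength]; omega⟩

theorem OnTopWalk.edist_le {m : Fin n} {v : Vertex H} (hv : OnTopWalk m v) :
    (reduction H).edist (rFirst H m) v ≤ topWalkLength m v :=
  edist_le_of_descent (S := {v | OnTopWalk m v}) (fun _ hu => hu.exists_lt) hv

section Between

variable {i j m : Fin n} (him : i < m) (hmj : m < j) (s : Side)

include him hmj

theorem nearEnd_ne_of_between : nearEnd i j s ≠ m := by
  cases s
  · exact him.ne
  · exact hmj.ne'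

theorem dist_branchTop_of_between :
    Nat.dist (branchTop i j s) (m.val * y n) + ((nearEnd i j s.swap).val + 1) =
      Nat.dist ((nearEnd i j s).val * y n) (m.val * y n) := by
  have := mul_y_add_le him
  have := mul_y_add_le hmj
  have := lt_y m.pos
  cases s <;> simp only [branchTop, nearEnd, Side.swap, Nat.dist] <;> omega

theorem dist_nearEnd_add_of_between :
    Nat.dist ((nearEnd i j s).val * y n) (m.val * y n) +
      Nat.dist ((nearEnd i j s.swap).val * y n) (m.val * y n) = j.val * y n - i.val * y n := by
  have := mul_y_add_le him
  have := mul_y_add_le hmj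
  cases s <;> simp only [nearEnd, Side.swap, Nat.dist] <;> omega

theorem y_le_dist_nearEnd_of_between :
    y n ≤ Nat.dist ((nearEnd i j s).val * y n) (m.val * y n) := by
  have := mul_y_add_le him
  have := mul_y_add_le hmj
  cases s <;> simp only [nearEnd, Nat.dist] <;> omega

end Between

theorem Exceptional.edist_rFirst_lt (hn : 2 ≤ n) {m : Fin n}
    (hm : ∀ a b, a < b → H.Adj a b → a < m ∧ m < b) {v w : Vertex H} (hvw : Exceptional v w) :
    (reduction H).edist (rFirst H m) w < (reduction H).edist (rFirst H m) v := by
  obtain ⟨h, hy, hh⟩ := exists_half_y hn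
  refine lt_of_lt_of_le ?_ (gadgetProfile_le_edist (q := .zero n) (i := m) (α := m)
    (t := ⟨0, m.pos⟩) hy hh rfl v)
  obtain ⟨s, i, j, i', j', hij, e, hij', e', k, hk, k', hk', hnear, hfar, hpos⟩ := hvw
  refine (OnTopWalk.branch s i' j' hij' e' k' hk').edist_le.trans_lt (Nat.cast_lt.2 ?_)
  obtain ⟨him, hmj⟩ := hm i j hij e
  obtain ⟨him', hmj'⟩ := hm i' j' hij' e'
  have hA := (gadgetProfile_arm_bounds h m m (.zero n) .right (nearEnd_ne_of_between him hmj s)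
    (nearEnd i j s.swap)).1
  have hB := (gadgetProfile_arm_bounds h m m (.zero n) .right
    (nearEnd_ne_of_between him hmj s.swap) (nearEnd i j s)).1
  have hC := dist_branchTop_of_between him hmj s
  have hC' := dist_branchTop_of_between him' hmj' s
  have hD := dist_branchTop_of_between him hmj s.swap
  have hG := dist_nearEnd_add_of_between him hmj s
  have hGy := y_le_dist_nearEnd_of_between him hmj s.swap
  have hL := edgeLen_eq hij hy
  rw [← hnear] at hC'
  rw [Side.swap_swap] at hD
  simp only [Profile.ext, topWalkLength]
  rw [edge_eq_edgeValue hij _ s hk.2.le]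
  simp only [gadgetProfile_line]
  apply le_edgeValue <;> simp only [Nat.dist] at * <;> omega

end IsolatedVertex

section EdgeGadget

variable {n : ℕ} {H : SimpleGraph (Fin n)}

theorem nearPos_mem_Ioo {L k : ℕ} (hk : 0 < k ∧ k < L) (s : Side) :
    0 < nearPos L k s ∧ nearPos L k s < L := by
  cases s <;> simp only [nearPos] <;> omega

theorem nearPos_nearPos {L k : ℕ} (hk : k ≤ L) (s : Side) : nearPos L (nearPos L k s) s = k := by
  cases s <;> simp only [nearPos]
  exact Nat.sub_sub_self hk

theorem mk_nearEnd (a b : Fin n) (s : Side) :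
    s(a, b) = s(nearEnd a b s.swap, nearEnd a b s) := by
  cases s
  · exact Sym2.eq_swap
  · rfl

theorem exists_nearEnd_of_adj {α i : Fin n} (hadj : H.Adj α i) :
    ∃ (a b : Fin n) (s : Side), a < b ∧ H.Adj a b ∧ nearEnd a b s.swap = α ∧
      nearEnd a b s = i := by
  rcases lt_or_gt_of_ne hadj.ne with hlt | hlt
  · exact ⟨α, i, .right, hlt, hadj, rfl, rfl⟩
  · exact ⟨i, α, .left, hlt, hadj.symm, rfl, rfl⟩

theorem adj_edgePath_rVertex {a b : Fin n} (hab : a < b) (e : H.Adj a b) (s : Side) {k : ℕ}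
    (hk : 0 < k ∧ k < edgeLen a b) (hpos : nearPos (edgeLen a b) k s = 1) :
    (reduction H).Adj (.edgePath a b hab e k hk)
      (rVertex H (nearEnd a b s) (nearEnd a b s.swap)) := by
  cases s with
  | left =>
    obtain rfl : k = 1 := hpos
    exact (Step.arm_edge a b hab e hk).adj.symm
  | right => exact (Step.edge_arm a b hab e k hk (by simp only [nearPos] at hpos; omega)).adj

theorem adj_edgePath_edgePath {a b : Fin n} (hab : a < b) (e : H.Adj a b) (s : Side) {k k' : ℕ}
    (hk : 0 < k ∧ k < edgeLen a b) (hk' : 0 < k' ∧ k' < edgeLen a b)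
    (hpos : nearPos (edgeLen a b) k s = nearPos (edgeLen a b) k' s + 1) :
    (reduction H).Adj (.edgePath a b hab e k hk) (.edgePath a b hab e k' hk') := by
  cases s with
  | left =>
    obtain rfl : k = k' + 1 := hpos
    exact (Step.edge_edge a b hab e k' hk' hk).adj.symm
  | right =>
    obtain rfl : k' = k + 1 := by simp only [nearPos] at hpos; omega
    exact (Step.edge_edge a b hab e k hk hk').adj

theorem eq_of_adj_rVertex {i t : Fin n} {v : Vertex H} (h : (reduction H).Adj (rVertex H i t) v) :
    (∃ t', (t'.val = t.val + 1 ∨ t.val = t'.val + 1) ∧ v = rVertex H i t') ∨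
      (t.val = 0 ∧ v = .anchor .top i) ∨ (t.val + 1 = n ∧ v = .anchor .bottom i) ∨
      ∃ a b hab e k hk s, nearEnd a b s = i ∧ nearEnd a b s.swap = t ∧
        nearPos (edgeLen a b) k s = 1 ∧ v = .edgePath a b hab e k hk := by
  rw [reduction, SimpleGraph.fromRel_adj] at h
  rcases h.2 with h | h
  · cases h with
    | arm_arm _ _ _ t' ht => exact Or.inl ⟨t', Or.inl ht, rfl⟩
    | arm_bottom _ _ _ ht => exact Or.inr (Or.inr (Or.inl ⟨ht, rfl⟩))
    | arm_edge _ _ hab e hk =>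
      exact Or.inr (Or.inr (Or.inr ⟨_, _, hab, e, 1, hk, .left, rfl, rfl, rfl, rfl⟩))
  · cases h with
    | top_arm _ _ _ ht => exact Or.inr (Or.inl ⟨ht, rfl⟩)
    | arm_arm _ _ t' _ ht => exact Or.inl ⟨t', Or.inr ht, rfl⟩
    | edge_arm _ _ hab e k hk hk1 =>
      exact Or.inr (Or.inr (Or.inr ⟨_, _, hab, e, k, hk, .right, rfl, rfl,
        by simp only [nearPos]; omega, rfl⟩))

theorem eq_of_adj_edgePath {a b : Fin n} {hab : a < b} {e : H.Adj a b} {k : ℕ}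
    {hk : 0 < k ∧ k < edgeLen a b} {v : Vertex H}
    (h : (reduction H).Adj (.edgePath a b hab e k hk) v) :
    (∃ k' hk', v = .edgePath a b hab e k' hk') ∨
      (∃ s, v = rVertex H (nearEnd a b s) (nearEnd a b s.swap)) ∨
      ∃ s hk', k = branchFoot a b s ∧ v = .branch s a b hab e 1 hk' := by
  rw [reduction, SimpleGraph.fromRel_adj] at h
  rcases h.2 with h | h
  · cases h with
    | edge_edge => exact Or.inl ⟨_, _, rfl⟩
    | edge_arm => exact Or.inr (Or.inl ⟨.right, rfl⟩)
    | edge_branch_left _ _ _ _ _ _ _ hky => exact Or.inr (Or.inr ⟨.left, _, hky, rfl⟩)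
    | edge_branch_right _ _ _ _ _ _ _ hky =>
      exact Or.inr (Or.inr ⟨.right, _, Nat.eq_sub_of_add_eq hky, rfl⟩)
  · cases h with
    | arm_edge => exact Or.inr (Or.inl ⟨.left, rfl⟩)
    | edge_edge => exact Or.inl ⟨_, _, rfl⟩

section Potential

variable {h : ℕ} {i α a b : Fin n} (q : CycleFun n) (hab : a < b) (s : Side)

include hab

theorem dist_nearEnd_swap_add (hy : y n = 2 * h) :
    Nat.dist ((nearEnd a b s.swap).val * y n) ((nearEnd a b s).val * y n) + 3 * h =
      edgeLen a b := by
  rw [dist_nearEnd_swap hab, edgeLen_eq hab hy]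

theorem gadgetProfile_arm_le_edge (hy : y n = 2 * h) (hh : 10 * n ≤ h) {k : ℕ}
    (hk : k ≤ edgeLen a b) (hpos : nearPos (edgeLen a b) k s = 1)
    (hi : nearEnd a b s = i ∨ nearEnd a b s.swap ≠ i) :
    (gadgetProfile h i α q).arm .right (nearEnd a b s) (nearEnd a b s.swap) ≤
      (gadgetProfile h i α q).edge a b k := by
  rw [edge_eq_edgeValue hab _ s hk, hpos]
  have hL := edgeLen_eq hab hy
  have hgap := mul_y_add_le hab
  by_cases hni : nearEnd a b s = i
  · have hA := q.arm_le .right (nearEnd a b s.swap)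
    rw [← hni, gadgetProfile_arm_self]
    apply le_edgeValue <;> simp only [Nat.dist] <;> omega
  · have hA := gadgetProfile_arm_bounds h i α q .right hni (nearEnd a b s.swap)
    have hB := gadgetProfile_arm_bounds h i α q .right (hi.resolve_left hni) (nearEnd a b s)
    have hG := Nat.dist.triangle_inequality ((nearEnd a b s).val * y n)
      ((nearEnd a b s.swap).val * y n) (i.val * y n)
    have hC := Nat.dist.triangle_inequality ((nearEnd a b s).val * y n) (branchTop a b s)
      (i.val * y n)
    have hD := Nat.dist.triangle_inequality ((nearEnd a b s).val * y n) (branchTop a b s.swap)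
      (i.val * y n)
    rw [Nat.dist_comm _ ((nearEnd a b s.swap).val * y n), dist_nearEnd_swap hab] at hG
    rw [Nat.dist_comm _ (branchTop a b s), dist_branchTop_nearEnd hab] at hC
    rw [Nat.dist_comm _ (branchTop a b s.swap), dist_branchTop_swap_nearEnd hab] at hD
    have hone : ∀ m, 1 ≤ m → Nat.dist m 1 = m - 1 := fun _ => Nat.dist_eq_sub_of_le_right
    rw [gadgetProfile_line, gadgetProfile_line]
    apply le_edgeValue
    · omega
    · rw [hone _ (by omega)]
      omega
    · rw [hone _ (by omega)]
      omega
    · rw [hone _ (by omega)]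
      omega

theorem gadgetProfile_edge (hy : y n = 2 * h) (hh : 10 * n ≤ h) {k : ℕ} (hk : k ≤ edgeLen a b) :
    (gadgetProfile h (nearEnd a b s) (nearEnd a b s.swap) q).edge a b k =
      q.arm .right (nearEnd a b s.swap) + nearPos (edgeLen a b) k s := by
  have hL := edgeLen_eq hab hy
  have hgap := mul_y_add_le hab
  have hq := q.arm_le .right (nearEnd a b s.swap)
  have hpos : nearPos (edgeLen a b) k s ≤ edgeLen a b := by
    cases s <;> simp only [nearPos] <;> omega
  rw [edge_eq_edgeValue hab _ s hk, gadgetProfile_arm_self,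
    gadgetProfile_arm_far h _ _ q .right (nearEnd_swap_ne hab s), if_pos rfl,
    dist_nearEnd_swap_add hab s hy, gadgetProfile_line, gadgetProfile_line,
    dist_branchTop_nearEnd hab, dist_branchTop_swap_nearEnd hab]
  have ha := (nearEnd a b s).isLt
  refine le_antisymm ?_ (le_edgeValue ?_ ?_ ?_ ?_)
  · exact edgeValue_le.1.trans (by rw [Nat.dist_zero_left])
  all_goals simp only [Nat.dist]; omega

theorem gadgetProfile_edge_le_branch (hy : y n = 2 * h) (hh : 10 * n ≤ h) (s' : Side) :
    (gadgetProfile h (nearEnd a b s) (nearEnd a b s.swap) q).edge a b (branchFoot a b s') ≤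
      (gadgetProfile h (nearEnd a b s) (nearEnd a b s.swap) q).branch s' a b 1 := by
  have hL := edgeLen_eq hab hy
  have hgap := mul_y_add_le hab
  have hq := q.arm_le .right (nearEnd a b s.swap)
  have ha := (nearEnd a b s).isLt
  rw [Profile.branch, pathValue_eq_min (by omega), gadgetProfile_line,
    gadgetProfile_edge q hab s hy hh (branchFoot_mem_Ioo hab s').2.le]
  refine le_min (Nat.le_succ _) ?_
  rcases Side.eq_or_eq_swap s s' with rfl | rfl
  · have hfoot := nearPos_branchFoot hab s
    rw [dist_branchTop_nearEnd hab]
    omega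
  · have hfoot := nearPos_branchFoot_swap a b s
    rw [dist_branchTop_swap_nearEnd hab]
    omega

end Potential

end EdgeGadget

section Route

variable {n h : ℕ} {H : SimpleGraph (Fin n)} {a b j : Fin n} {s : Side}

theorem dist_le_of_mem_uIcc {α t : Fin n} (ht : t ∈ Set.uIcc α j) :
    Nat.dist t.val j.val ≤ Nat.dist α.val j.val := by
  simp only [Set.mem_uIcc, Fin.le_def] at ht
  simp only [Nat.dist]
  omega

theorem eq_of_mem_uIcc_of_dist_eq {α t t' : Fin n} (ht : t ∈ Set.uIcc α j)
    (ht' : t' ∈ Set.uIcc α j) (h : Nat.dist t.val j.val = Nat.dist t'.val j.val) : t = t' := by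
  simp only [Set.mem_uIcc, Fin.le_def] at ht ht'
  simp only [Nat.dist] at h
  omega

theorem mem_gadgetRoute_nearEnd (hab : a < b) (e : H.Adj a b) {x : Vertex H} :
    x ∈ gadgetRoute H (nearEnd a b s.swap) (nearEnd a b s) j ↔
      (∃ t ≤ nearEnd a b s, x = rVertex H (nearEnd a b s.swap) t) ∨
      (∃ k hk, x = .edgePath a b hab e k hk) ∨
      ∃ t ∈ Set.uIcc (nearEnd a b s.swap) j, x = rVertex H (nearEnd a b s) t := by
  refine or_congr Iff.rfl (or_congr ⟨?_, ?_⟩ Iff.rfl)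
  · rintro ⟨a', b', hab', e', k, hk, hs, rfl⟩
    rw [← mk_nearEnd, Sym2.eq_iff] at hs
    rcases hs with ⟨rfl, rfl⟩ | ⟨rfl, rfl⟩
    · exact ⟨k, hk, rfl⟩
    · exact absurd hab hab'.asymm
  · rintro ⟨k, hk, rfl⟩
    exact ⟨a, b, hab, e, k, hk, mk_nearEnd a b s, rfl⟩

theorem ext_rVertex_start (hab : a < b) (hy : y n = 2 * h) (q : CycleFun n) (t : Fin n) :
    (gadgetProfile h (nearEnd a b s) (nearEnd a b s.swap) q).ext
        (rVertex H (nearEnd a b s.swap) t) =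
      edgeLen a b + q.arm .right (nearEnd a b s.swap) + Nat.dist t.val (nearEnd a b s).val := by
  rw [← dist_nearEnd_swap_add hab s hy]
  simp only [Profile.ext, gadgetProfile, if_neg (nearEnd_swap_ne hab s), if_true]

theorem ext_rVertex_end {i α : Fin n} (q : CycleFun n) (t : Fin n) :
    (gadgetProfile h i α q).ext (rVertex H i t) = q.arm .right t :=
  gadgetProfile_arm_self h i α q .right t

/-- The potential that certifies the route from `r^α_1` to `r^i_j`, where `i` is the end of the
edge `ab` on the side `s` and `α` is the other end: on the route, it is the remaining length. -/
noncomputable def routePotential (h : ℕ) (a b : Fin n) (s : Side) (j : Fin n) : Vertex H → ℕ :=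
  (gadgetProfile h (nearEnd a b s) (nearEnd a b s.swap) (.height j)).ext

theorem routePotential_start (hab : a < b) (hy : y n = 2 * h) (t : Fin n) :
    routePotential h a b s j (rVertex H (nearEnd a b s.swap) t) =
      edgeLen a b + Nat.dist (nearEnd a b s.swap).val j.val + Nat.dist t.val (nearEnd a b s).val :=
  ext_rVertex_start hab hy (.height j) t

theorem routePotential_edgePath (hab : a < b) (e : H.Adj a b) (hy : y n = 2 * h)
    (hh : 10 * n ≤ h) {k : ℕ} (hk : 0 < k ∧ k < edgeLen a b) :
    routePotential h a b s j (.edgePath a b hab e k hk) =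
      Nat.dist (nearEnd a b s.swap).val j.val + nearPos (edgeLen a b) k s :=
  gadgetProfile_edge (.height j) hab s hy hh hk.2.le

theorem routePotential_end (t : Fin n) :
    routePotential h a b s j (rVertex H (nearEnd a b s) t) = Nat.dist t.val j.val :=
  ext_rVertex_end (.height j) t

theorem injOn_routePotential (hab : a < b) (e : H.Adj a b) (hy : y n = 2 * h) (hh : 10 * n ≤ h) :
    Set.InjOn (routePotential h a b s j)
      (gadgetRoute H (nearEnd a b s.swap) (nearEnd a b s) j) := by
  intro x hx x' hx' heq
  have hL := two_mul_y_lt_edgeLen hab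
  rw [mem_gadgetRoute_nearEnd hab e] at hx hx'
  rcases hx with ⟨t, ht, rfl⟩ | ⟨k, hk, rfl⟩ | ⟨t, ht, rfl⟩ <;>
    rcases hx' with ⟨t', ht', rfl⟩ | ⟨k', hk', rfl⟩ | ⟨t', ht', rfl⟩ <;>
    simp only [routePotential_start hab hy, routePotential_edgePath hab e hy hh,
      routePotential_end] at heq
  · rw [Nat.add_left_cancel_iff, Nat.dist_eq_sub_of_le ht, Nat.dist_eq_sub_of_le ht'] at heq
    rw [show t = t' by omega]
  · have := (nearPos_mem_Ioo hk' s).2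
    omega
  · have := dist_le_of_mem_uIcc ht'
    omega
  · have := (nearPos_mem_Ioo hk s).2
    omega
  · obtain rfl : k = k' := by
      rw [← nearPos_nearPos hk.2.le s, Nat.add_left_cancel heq, nearPos_nearPos hk'.2.le s]
    rfl
  · have := (nearPos_mem_Ioo hk s).1
    have := dist_le_of_mem_uIcc ht'
    omega
  · have := dist_le_of_mem_uIcc ht
    omega
  · have := (nearPos_mem_Ioo hk' s).1
    have := dist_le_of_mem_uIcc ht
    omega
  · rw [eq_of_mem_uIcc_of_dist_eq ht ht' heq]

section Closed

variable {v : Vertex H}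

theorem mem_gadgetRoute_of_adj_start (hab : a < b) (hy : y n = 2 * h) (hh : 10 * n ≤ h)
    {t : Fin n} (ht : t ≤ nearEnd a b s)
    (hadj : (reduction H).Adj (rVertex H (nearEnd a b s.swap) t) v)
    (hlt : routePotential h a b s j v <
      routePotential h a b s j (rVertex H (nearEnd a b s.swap) t)) :
    v ∈ gadgetRoute H (nearEnd a b s.swap) (nearEnd a b s) j := by
  rw [Fin.le_def] at ht
  rcases eq_of_adj_rVertex hadj with ⟨t', ht', rfl⟩ | ⟨ht0, rfl⟩ | ⟨htn, rfl⟩ |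
    ⟨a', b', hab', e', k, hk, s', hα, rfl, hpos, rfl⟩
  · rw [routePotential_start hab hy, routePotential_start hab hy] at hlt
    simp only [Nat.dist] at hlt
    exact Or.inl ⟨t', by rw [Fin.le_def]; omega, rfl⟩
  · rw [routePotential_start hab hy, ← dist_nearEnd_swap_add hab s hy] at hlt
    simp only [routePotential, Profile.ext, gadgetProfile, if_neg (nearEnd_swap_ne hab s), if_true,
      CycleFun.height, Nat.add_lt_add_iff_left, Nat.dist] at hlt
    omega
  · rw [routePotential_start hab hy, ← dist_nearEnd_swap_add hab s hy] at hlt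
    simp only [routePotential, Profile.ext, gadgetProfile, if_neg (nearEnd_swap_ne hab s), if_true,
      CycleFun.height, Nat.add_lt_add_iff_left, Nat.dist] at hlt
    omega
  · by_cases hi : nearEnd a' b' s'.swap = nearEnd a b s
    · rw [← hα, ← hi]
      exact Or.inr (Or.inl ⟨a', b', hab', e', k, hk, (mk_nearEnd a' b' s').trans Sym2.eq_swap, rfl⟩)
    · rw [← hα] at hlt
      exact absurd hlt
        (not_lt_of_ge (gadgetProfile_arm_le_edge _ hab' s' hy hh hk.2.le hpos (Or.inr hi)))

theorem mem_gadgetRoute_of_adj_edgePath (hab : a < b) (e : H.Adj a b) (hy : y n = 2 * h)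
    (hh : 10 * n ≤ h) {k : ℕ} {hk : 0 < k ∧ k < edgeLen a b}
    (hadj : (reduction H).Adj (.edgePath a b hab e k hk) v)
    (hlt : routePotential h a b s j v < routePotential h a b s j (.edgePath a b hab e k hk)) :
    v ∈ gadgetRoute H (nearEnd a b s.swap) (nearEnd a b s) j := by
  rw [mem_gadgetRoute_nearEnd hab e]
  rcases eq_of_adj_edgePath hadj with ⟨k', hk', rfl⟩ | ⟨s', rfl⟩ | ⟨s', hk', rfl, rfl⟩
  · exact Or.inr (Or.inl ⟨k', hk', rfl⟩)
  · rcases Side.eq_or_eq_swap s s' with rfl | rfl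
    · exact Or.inr (Or.inr ⟨_, Set.left_mem_uIcc, rfl⟩)
    · exact Or.inl ⟨_, le_rfl, by rw [Side.swap_swap]⟩
  · exact absurd hlt (not_lt_of_ge (gadgetProfile_edge_le_branch _ hab s hy hh s'))

theorem mem_gadgetRoute_of_adj_end (hy : y n = 2 * h) (hh : 10 * n ≤ h) {t : Fin n}
    (ht : t ∈ Set.uIcc (nearEnd a b s.swap) j)
    (hadj : (reduction H).Adj (rVertex H (nearEnd a b s) t) v)
    (hlt : routePotential h a b s j v < routePotential h a b s j (rVertex H (nearEnd a b s) t)) :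
    v ∈ gadgetRoute H (nearEnd a b s.swap) (nearEnd a b s) j := by
  rw [routePotential_end] at hlt
  rcases eq_of_adj_rVertex hadj with ⟨t', ht', rfl⟩ | ⟨ht0, rfl⟩ | ⟨htn, rfl⟩ |
    ⟨a', b', hab', e', k, hk, s', hi, rfl, hpos, rfl⟩
  · rw [routePotential_end] at hlt
    simp only [Nat.dist] at hlt
    refine Or.inr (Or.inr ⟨t', ?_, rfl⟩)
    simp only [Set.mem_uIcc, Fin.le_def] at ht ⊢
    omega
  · simp only [routePotential, Profile.ext, gadgetProfile, if_true, CycleFun.height, Nat.dist]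
      at hlt
    omega
  · simp only [routePotential, Profile.ext, gadgetProfile, if_true, CycleFun.height, Nat.dist]
      at hlt
    omega
  · have hle := gadgetProfile_arm_le_edge (α := nearEnd a b s.swap) (.height j) hab' s' hy hh
      hk.2.le hpos (Or.inl hi)
    rw [hi, gadgetProfile_arm_self] at hle
    exact absurd hlt (not_lt_of_ge hle)

end Closed

section Descent

theorem exists_mem_gadgetRoute_lt_start (hab : a < b) (e : H.Adj a b) (hy : y n = 2 * h)
    (hh : 10 * n ≤ h) {t : Fin n} (ht : t ≤ nearEnd a b s) :
    ∃ v ∈ gadgetRoute H (nearEnd a b s.swap) (nearEnd a b s) j,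
      (reduction H).Adj (rVertex H (nearEnd a b s.swap) t) v ∧
        routePotential h a b s j v <
          routePotential h a b s j (rVertex H (nearEnd a b s.swap) t) := by
  rcases ht.lt_or_eq with hlt | rfl
  · rw [Fin.lt_def] at hlt
    refine ⟨rVertex H (nearEnd a b s.swap) ⟨t.val + 1, by omega⟩,
      Or.inl ⟨_, by rw [Fin.le_def]; exact hlt, rfl⟩, (Step.arm_arm .right _ _ _ rfl).adj, ?_⟩
    rw [routePotential_start hab hy, routePotential_start hab hy]
    simp only [Nat.dist]
    omega
  · have hL := two_mul_y_lt_edgeLen hab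
    have hyn := lt_y (Fin.pos a)
    have hk : 0 < nearPos (edgeLen a b) 1 s.swap ∧
        nearPos (edgeLen a b) 1 s.swap < edgeLen a b :=
      nearPos_mem_Ioo (by omega) _
    have hadj := adj_edgePath_rVertex hab e s.swap hk (nearPos_nearPos (by omega) _)
    rw [Side.swap_swap] at hadj
    refine ⟨_, (mem_gadgetRoute_nearEnd hab e).2 (Or.inr (Or.inl ⟨_, hk, rfl⟩)), hadj.symm, ?_⟩
    rw [routePotential_start hab hy, routePotential_edgePath hab e hy hh, Nat.dist_self]
    have := (nearPos_mem_Ioo hk s).2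
    omega

theorem exists_mem_gadgetRoute_lt_edgePath (hab : a < b) (e : H.Adj a b) (hy : y n = 2 * h)
    (hh : 10 * n ≤ h) {k : ℕ} (hk : 0 < k ∧ k < edgeLen a b) :
    ∃ v ∈ gadgetRoute H (nearEnd a b s.swap) (nearEnd a b s) j,
      (reduction H).Adj (.edgePath a b hab e k hk) v ∧
        routePotential h a b s j v < routePotential h a b s j (.edgePath a b hab e k hk) := by
  have hpos := nearPos_mem_Ioo hk s
  rw [routePotential_edgePath hab e hy hh]
  by_cases hone : nearPos (edgeLen a b) k s = 1
  · refine ⟨_, Or.inr (Or.inr ⟨_, Set.left_mem_uIcc, rfl⟩),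
      adj_edgePath_rVertex hab e s hk hone, ?_⟩
    rw [routePotential_end]
    omega
  · have hlt : 0 < nearPos (edgeLen a b) k s - 1 ∧ nearPos (edgeLen a b) k s - 1 < edgeLen a b := by
      omega
    have hk' := nearPos_mem_Ioo hlt s
    have hback := nearPos_nearPos hlt.2.le s
    refine ⟨_, (mem_gadgetRoute_nearEnd hab e).2 (Or.inr (Or.inl ⟨_, hk', rfl⟩)),
      adj_edgePath_edgePath hab e s hk hk' (by omega), ?_⟩
    rw [routePotential_edgePath hab e hy hh]
    omega

theorem exists_mem_gadgetRoute_lt_end {t : Fin n} (ht : t ∈ Set.uIcc (nearEnd a b s.swap) j)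
    (hne : t ≠ j) :
    ∃ v ∈ gadgetRoute H (nearEnd a b s.swap) (nearEnd a b s) j,
      (reduction H).Adj (rVertex H (nearEnd a b s) t) v ∧
        routePotential h a b s j v < routePotential h a b s j (rVertex H (nearEnd a b s) t) := by
  rw [routePotential_end]
  simp only [Set.mem_uIcc, Fin.le_def] at ht
  rcases lt_or_gt_of_ne hne with hlt | hlt <;> rw [Fin.lt_def] at hlt
  · refine ⟨rVertex H (nearEnd a b s) ⟨t.val + 1, by omega⟩, Or.inr (Or.inr ⟨_, ?_, rfl⟩),
      (Step.arm_arm .right _ _ _ rfl).adj, ?_⟩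
    · simp only [Set.mem_uIcc, Fin.le_def]
      omega
    · rw [routePotential_end]
      simp only [Nat.dist]
      omega
  · refine ⟨rVertex H (nearEnd a b s) ⟨t.val - 1, by omega⟩, Or.inr (Or.inr ⟨_, ?_, rfl⟩),
      (Step.arm_arm .right _ _ _ (Nat.sub_add_cancel (by omega)).symm).adj.symm, ?_⟩
    · simp only [Set.mem_uIcc, Fin.le_def]
      omega
    · rw [routePotential_end]
      simp only [Nat.dist]
      omega

end Descent

theorem mem_gadgetRoute_of_adj (hab : a < b) (e : H.Adj a b) (hy : y n = 2 * h)
    (hh : 10 * n ≤ h) {u v : Vertex H}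
    (hu : u ∈ gadgetRoute H (nearEnd a b s.swap) (nearEnd a b s) j) (hadj : (reduction H).Adj u v)
    (hlt : routePotential h a b s j v < routePotential h a b s j u) :
    v ∈ gadgetRoute H (nearEnd a b s.swap) (nearEnd a b s) j := by
  rcases (mem_gadgetRoute_nearEnd hab e).1 hu with ⟨t, ht, rfl⟩ | ⟨k, hk, rfl⟩ | ⟨t, ht, rfl⟩
  · exact mem_gadgetRoute_of_adj_start hab hy hh ht hadj hlt
  · exact mem_gadgetRoute_of_adj_edgePath hab e hy hh hadj hlt
  · exact mem_gadgetRoute_of_adj_end hy hh ht hadj hlt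

theorem exists_mem_gadgetRoute_lt (hab : a < b) (e : H.Adj a b) (hy : y n = 2 * h)
    (hh : 10 * n ≤ h) {u : Vertex H}
    (hu : u ∈ gadgetRoute H (nearEnd a b s.swap) (nearEnd a b s) j)
    (hne : u ≠ rVertex H (nearEnd a b s) j) :
    ∃ v ∈ gadgetRoute H (nearEnd a b s.swap) (nearEnd a b s) j,
      (reduction H).Adj u v ∧ routePotential h a b s j v < routePotential h a b s j u := by
  rcases (mem_gadgetRoute_nearEnd hab e).1 hu with ⟨t, ht, rfl⟩ | ⟨k, hk, rfl⟩ | ⟨t, ht, rfl⟩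
  · exact exists_mem_gadgetRoute_lt_start hab e hy hh ht
  · exact exists_mem_gadgetRoute_lt_edgePath hab e hy hh hk
  · exact exists_mem_gadgetRoute_lt_end ht (by rintro rfl; exact hne rfl)

theorem routePotential_le_of_mem_gadgetRoute (hab : a < b) (e : H.Adj a b) (hy : y n = 2 * h)
    (hh : 10 * n ≤ h) {x : Vertex H}
    (hx : x ∈ gadgetRoute H (nearEnd a b s.swap) (nearEnd a b s) j) :
    routePotential h a b s j x ≤
      edgeLen a b + Nat.dist (nearEnd a b s.swap).val j.val + (nearEnd a b s).val := by
  rcases (mem_gadgetRoute_nearEnd hab e).1 hx with ⟨t, ht, rfl⟩ | ⟨k, hk, rfl⟩ | ⟨t, ht, rfl⟩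
  · rw [routePotential_start hab hy, Nat.dist_eq_sub_of_le ht]
    omega
  · have := (nearPos_mem_Ioo hk s).2
    rw [routePotential_edgePath hab e hy hh]
    omega
  · have := dist_le_of_mem_uIcc ht
    rw [routePotential_end]
    omega

theorem exists_unique_shortest_walk_nearEnd (hab : a < b) (e : H.Adj a b) (hy : y n = 2 * h)
    (hh : 10 * n ≤ h) (j : Fin n) :
    ∃ P : (reduction H).Walk (rFirst H (nearEnd a b s.swap)) (rVertex H (nearEnd a b s) j),
      P.length = edgeLen a b + Nat.dist (nearEnd a b s.swap).val j.val + (nearEnd a b s).val ∧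
      (∀ x, x ∈ P.support ↔ x ∈ gadgetRoute H (nearEnd a b s.swap) (nearEnd a b s) j) ∧
      ∀ Q, Q ≠ P → P.length < Q.length := by
  have hfirst : routePotential h a b s j (rFirst H (nearEnd a b s.swap)) =
      edgeLen a b + Nat.dist (nearEnd a b s.swap).val j.val + (nearEnd a b s).val := by
    rw [rFirst, routePotential_start hab hy, Nat.dist_zero_left]
  have hstart : rFirst H (nearEnd a b s.swap) ∈
      gadgetRoute H (nearEnd a b s.swap) (nearEnd a b s) j :=
    Or.inl ⟨_, Fin.le_def.2 (Nat.zero_le _), rfl⟩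
  have hend : rVertex H (nearEnd a b s) j ∈
      gadgetRoute H (nearEnd a b s.swap) (nearEnd a b s) j :=
    Or.inr (Or.inr ⟨j, Set.right_mem_uIcc, rfl⟩)
  obtain ⟨P, hlen, hsupp, huniq⟩ := exists_unique_shortest_walk hend
    (injOn_routePotential hab e hy hh) (by rw [routePotential_end, Nat.dist_self])
    (gadgetProfile_isLipschitz (.height j) hy hh).ext_le_add_one
    (fun _ hu _ => mem_gadgetRoute_of_adj hab e hy hh hu)
    (fun _ => exists_mem_gadgetRoute_lt hab e hy hh) hstart
  rw [hfirst] at hlen hsupp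
  exact ⟨P, hlen, fun x => (hsupp x).trans
    (and_iff_left_of_imp (routePotential_le_of_mem_gadgetRoute hab e hy hh)), huniq⟩

end Route

section ShortestRoutes

variable {n : ℕ} {H : SimpleGraph (Fin n)}

theorem exists_unique_shortest_gadgetRoute (hn : 2 ≤ n) {α i : Fin n} (hadj : H.Adj α i)
    (j : Fin n) :
    ∃ P : (reduction H).Walk (rFirst H α) (rVertex H i j),
      (∀ x, x ∈ P.support ↔ x ∈ gadgetRoute H α i j) ∧ ∀ Q, Q ≠ P → P.length < Q.length := by
  obtain ⟨a, b, s, hab, e, rfl, rfl⟩ := exists_nearEnd_of_adj hadj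
  obtain ⟨h, hy, hh⟩ := exists_half_y hn
  obtain ⟨P, -, hP⟩ := exists_unique_shortest_walk_nearEnd hab e hy hh j
  exact ⟨P, hP⟩

theorem edist_rFirst_rVertex_le (i j : Fin n) :
    (reduction H).edist (rFirst H i) (rVertex H i j) ≤ j.val := by
  let f : Vertex H → ℕ
    | .arm _ _ t => t.val
    | _ => 0
  refine edist_le_of_descent (f := f) (S := Set.range (rVertex H i)) ?_ ⟨j, rfl⟩
  rintro _ ⟨t, rfl⟩
  rcases Nat.eq_zero_or_pos t.val with ht | ht
  · exact Or.inl (congrArg (rVertex H i) (Fin.ext ht))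
  · exact Or.inr ⟨_, ⟨⟨t.val - 1, by omega⟩, rfl⟩,
      (Step.arm_arm .right i _ t (Nat.sub_add_cancel ht).symm).adj, Nat.sub_lt ht one_pos⟩

theorem edist_rFirst_ne_of_dominates (hn : 2 ≤ n) {α i : Fin n} (hαi : α = i ∨ H.Adj i α)
    (j : Fin n) :
    (reduction H).edist (rFirst H α) (.arm .left i j) ≠
      (reduction H).edist (rFirst H α) (rVertex H i j) := by
  obtain ⟨h, hy, hh⟩ := exists_half_y hn
  have hlower : ∀ α,
      ((gadgetProfile h i α (.toLeft j)).ext (rFirst H α) : ℕ∞) ≤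
        (reduction H).edist (rFirst H α) (.arm .left i j) := fun α => by
    rw [SimpleGraph.edist_comm]
    exact gadgetProfile_le_edist hy hh (Nat.dist_self j) _
  refine (lt_of_lt_of_le ?_ (hlower α)).ne'
  rcases hαi with rfl | hadj
  · refine (edist_rFirst_rVertex_le α j).trans_lt (Nat.cast_lt.2 ?_)
    rw [rFirst, ext_rVertex_end]
    simp only [CycleFun.toLeft]
    omega
  · obtain ⟨a, b, s, hab, e, rfl, rfl⟩ := exists_nearEnd_of_adj hadj.symm
    obtain ⟨P, hlen, -⟩ := exists_unique_shortest_walk_nearEnd hab e hy hh j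
    refine (SimpleGraph.Walk.edist_le P).trans_lt (Nat.cast_lt.2 ?_)
    rw [hlen, rFirst, ext_rVertex_start hab hy]
    simp only [CycleFun.toLeft, Nat.dist]
    omega

end ShortestRoutes

section MetricBasis

variable {n : ℕ} {H : SimpleGraph (Fin n)}

theorem isMetricBasis_basisOf (hn : 2 ≤ n) {m : Fin n}
    (hm : ∀ a b, a < b → H.Adj a b → a < m ∧ m < b) {K : Set (Fin n)} (hK : IsDominatingSet H K)
    (hmK : m ∈ K) (β : Row → Side → Bool) : IsMetricBasis (reduction H) (basisOf H β K) := by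
  intro v w hne
  by_contra! hcon
  have hcorner : ∀ c s, cornerDist β c s v = cornerDist β c s w := fun c s => by
    have := hcon _ (Or.inl ⟨c, s, rfl⟩)
    rw [edist_corner (by omega), edist_corner (by omega), Nat.cast_inj] at this
    rw [cornerDist, cornerDist, this]
  have hfirst : ∀ i ∈ K, (reduction H).edist (rFirst H i) v = (reduction H).edist (rFirst H i) w :=
    fun i hi => hcon _ (Or.inr ⟨i, hi, rfl⟩)
  rcases eq_or_areTwins_or_exceptional hn β hcorner with heq | ⟨s, i, j, rfl, rfl⟩ | hex | hex
  · exact hne heq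
  · obtain ⟨α, hα, hαi⟩ := hK i
    have htwins := edist_rFirst_ne_of_dominates hn hαi j
    cases s with
    | left => exact htwins (hfirst α hα)
    | right => exact htwins (hfirst α hα).symm
  · exact (hex.edist_rFirst_lt hn hm).ne (hfirst m hmK).symm
  · exact (hex.edist_rFirst_lt hn hm).ne (hfirst m hmK)

theorem encard_basisOf_le (β : Row → Side → Bool) (K : Set (Fin n)) :
    (basisOf H β K).encard ≤ K.encard + 4 := by
  have hcorners : {x : Vertex H | ∃ c s, x = .pendLeaf c s (β c s)}.encard ≤ 4 := by
    have hsub : {x : Vertex H | ∃ c s, x = .pendLeaf c s (β c s)} ⊆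
        (fun p : Row × Side => .pendLeaf p.1 p.2 (β p.1 p.2)) ''
          ↑({(.top, .left), (.top, .right), (.bottom, .left), (.bottom, .right)} :
            Finset (Row × Side)) := by
      rintro x ⟨c, s, rfl⟩
      exact ⟨(c, s), by cases c <;> cases s <;> decide, rfl⟩
    refine (Set.encard_le_encard hsub).trans ((Set.encard_image_le _ _).trans ?_)
    exact (Set.encard_coe_eq_coe_finsetCard _).le
  rw [add_comm]
  exact (Set.encard_union_le _ _).trans (add_le_add hcorners (Set.encard_image_le _ _))

end MetricBasis

section Padded

variable {V : Type*} {G₀ : SimpleGraph V} {n h : ℕ} {num : V ⊕ Fin 2 ≃ Fin n}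

theorem isDominatingSet_addTwoIsolated {K : Set V} (hK : IsDominatingSet G₀ K) :
    IsDominatingSet (addTwoIsolated G₀) (Sum.inl '' K ∪ Set.range Sum.inr) := by
  rintro (x | x)
  · obtain ⟨d, hd, hdx⟩ := hK x
    exact ⟨Sum.inl d, Or.inl ⟨d, hd, rfl⟩, hdx.imp (congrArg Sum.inl) id⟩
  · exact ⟨Sum.inr x, Or.inr ⟨x, rfl⟩, Or.inl rfl⟩

theorem HasDominatingSet.addTwoIsolated (hG : HasDominatingSet G₀ h) :
    HasDominatingSet (addTwoIsolated G₀) (h + 2) := by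
  obtain ⟨K, hK, hcard⟩ := hG
  refine ⟨_, isDominatingSet_addTwoIsolated hK, (Set.encard_union_le _ _).trans ?_⟩
  rw [Nat.cast_add, ← Set.image_univ]
  refine add_le_add ((Set.encard_image_le _ _).trans hcard) ((Set.encard_image_le _ _).trans ?_)
  rw [Set.encard_univ, ENat.card_eq_coe_fintype_card, Fintype.card_fin]

theorem inr_mem_of_isDominatingSet {K : Set (V ⊕ Fin 2)}
    (hK : IsDominatingSet (addTwoIsolated G₀) K) (x : Fin 2) : Sum.inr x ∈ K := by
  obtain ⟨d, hd, rfl | hadj⟩ := hK (Sum.inr x)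
  · exact hd
  · cases d <;> simp [addTwoIsolated] at hadj

theorem IsDominatingSet.image_numbered {W : Type*} {G : SimpleGraph W} {num : W ≃ Fin n}
    {K : Set W} (hK : IsDominatingSet G K) : IsDominatingSet (numbered G num) (num '' K) := by
  intro i
  obtain ⟨d, hd, hdi⟩ := hK (num.symm i)
  refine ⟨num d, ⟨d, hd, rfl⟩, hdi.imp (fun h => ?_) fun hadj => ?_⟩
  · rw [h, Equiv.apply_symm_apply]
  · rwa [numbered, SimpleGraph.comap_adj, Equiv.symm_apply_apply]

theorem two_le_of_inr_lt (hnew : num (Sum.inr 0) < num (Sum.inr 1)) : 2 ≤ n := by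
  rw [Fin.lt_def] at hnew
  omega

theorem padded_adj_separated {V₁ V₂ : Set V} (hbip : G₀.IsBipartiteWith V₁ V₂)
    (hV₁ : ∀ x ∈ V₁, num (Sum.inl x) < num (Sum.inr 0))
    (hnew : num (Sum.inr 0) < num (Sum.inr 1))
    (hV₂ : ∀ x ∈ V₂, num (Sum.inr 1) < num (Sum.inl x)) (a b : Fin n) (hab : a < b)
    (e : (padded G₀ num).Adj a b) : a < num (Sum.inr 0) ∧ num (Sum.inr 0) < b := by
  obtain ⟨x, rfl⟩ := num.surjective a
  obtain ⟨z, rfl⟩ := num.surjective b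
  rw [padded, numbered, SimpleGraph.comap_adj, Equiv.symm_apply_apply,
    Equiv.symm_apply_apply] at e
  rcases x with x | x <;> rcases z with z | z <;>
    simp only [addTwoIsolated, SimpleGraph.sum_adj, SimpleGraph.bot_adj] at e
  rcases hbip.mem_of_adj e with ⟨hx, hz⟩ | ⟨hx, hz⟩
  · exact ⟨hV₁ x hx, hnew.trans (hV₂ z hz)⟩
  · exact absurd hab (((hV₁ z hz).trans hnew).trans (hV₂ x hx)).asymm

theorem isMetricBasis_basisOf_padded {V₁ V₂ : Set V} (hbip : G₀.IsBipartiteWith V₁ V₂)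
    (hV₁ : ∀ x ∈ V₁, num (Sum.inl x) < num (Sum.inr 0))
    (hnew : num (Sum.inr 0) < num (Sum.inr 1))
    (hV₂ : ∀ x ∈ V₂, num (Sum.inr 1) < num (Sum.inl x)) {K : Set (V ⊕ Fin 2)}
    (hK : IsDominatingSet (addTwoIsolated G₀) K) (β : Row → Side → Bool) :
    IsMetricBasis (reduction (padded G₀ num)) (basisOf (padded G₀ num) β (num '' K)) :=
  isMetricBasis_basisOf (two_le_of_inr_lt hnew) (padded_adj_separated hbip hV₁ hnew hV₂)
    hK.image_numbered ⟨_, inr_mem_of_isDominatingSet hK 0, rfl⟩ β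

theorem encard_basisOf_image_le {K : Set (V ⊕ Fin 2)} (hcard : K.encard ≤ h)
    (β : Row → Side → Bool) : (basisOf (padded G₀ num) β (num '' K)).encard ≤ h + 4 :=
  (encard_basisOf_le β _).trans (by gcongr; exact (Set.encard_image_le _ _).trans hcard)

end Padded

end MetricDim

theorem mainTheorem5 {V : Type*} (G₀ : SimpleGraph V) (V₁ V₂ : Set V)
    (hbip : G₀.IsBipartiteWith V₁ V₂) (hcover : V₁ ∪ V₂ = Set.univ)
    (n : ℕ) (num : V ⊕ Fin 2 ≃ Fin n)
    (hV₁ : ∀ x ∈ V₁, num (Sum.inl x) < num (Sum.inr 0))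
    (hnew : num (Sum.inr 0) < num (Sum.inr 1))
    (hV₂ : ∀ x ∈ V₂, num (Sum.inr 1) < num (Sum.inl x)) (h : ℕ) :
    (MetricDim.HasDominatingSet (MetricDim.addTwoIsolated G₀) h →
      MetricDim.HasMetricBasis (MetricDim.reduction (MetricDim.padded G₀ num)) (h + 4)) ∧
    (MetricDim.HasDominatingSet G₀ h →
      MetricDim.HasMetricBasis (MetricDim.reduction (MetricDim.padded G₀ num)) ((h + 2) + 4)) ∧
    (∀ K : Set (V ⊕ Fin 2),
      MetricDim.IsDominatingSet (MetricDim.addTwoIsolated G₀) K → K.encard ≤ h →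
      ∀ b : MetricDim.Row → MetricDim.Side → Bool,
        MetricDim.IsMetricBasis (MetricDim.reduction (MetricDim.padded G₀ num))
          (MetricDim.basisOf (MetricDim.padded G₀ num) b (num '' K)) ∧
        (MetricDim.basisOf (MetricDim.padded G₀ num) b (num '' K)).encard ≤ h + 4) ∧
    (∀ α i j : Fin n, (MetricDim.padded G₀ num).Adj α i →
      ∃ P : (MetricDim.reduction (MetricDim.padded G₀ num)).Walk
          (MetricDim.rFirst (MetricDim.padded G₀ num) α)
          (MetricDim.rVertex (MetricDim.padded G₀ num) i j),
        (∀ x, x ∈ P.support ↔ x ∈ MetricDim.gadgetRoute (MetricDim.padded G₀ num) α i j) ∧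
        ∀ Q : (MetricDim.reduction (MetricDim.padded G₀ num)).Walk
            (MetricDim.rFirst (MetricDim.padded G₀ num) α)
            (MetricDim.rVertex (MetricDim.padded G₀ num) i j),
          Q ≠ P → P.length < Q.length) := by
  have hbasis : ∀ {K}, MetricDim.IsDominatingSet (MetricDim.addTwoIsolated G₀) K →
      ∀ b, MetricDim.IsMetricBasis (MetricDim.reduction (MetricDim.padded G₀ num))
        (MetricDim.basisOf (MetricDim.padded G₀ num) b (num '' K)) :=
    MetricDim.isMetricBasis_basisOf_padded hbip hV₁ hnew hV₂
  have hdom : ∀ h, MetricDim.HasDominatingSet (MetricDim.addTwoIsolated G₀) h →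
      MetricDim.HasMetricBasis (MetricDim.reduction (MetricDim.padded G₀ num)) (h + 4) :=
    fun _ ⟨_, hK, hcard⟩ => ⟨_, hbasis hK fun _ _ => true,
      MetricDim.encard_basisOf_image_le hcard _⟩
  exact ⟨hdom h, fun hG => hdom (h + 2) hG.addTwoIsolated,
    fun _ hK hcard b => ⟨hbasis hK b, MetricDim.encard_basisOf_image_le hcard b⟩,
    fun _ _ j hadj => MetricDim.exists_unique_shortest_gadgetRoute
      (MetricDim.two_le_of_inr_lt hnew) hadj j⟩
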